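/- A set $X\subset\mathbb R^d$ of unit vectors spans a system of biangular lines if no two members of $X$ are antipodal and the inner products of distinct members of $X$ take at most two values up to sign, i.e. $|\{\langle x,y\rangle^2 : x\neq y\in X\}|\le 2$. A Gram matrix of the spanned line system is the Gram matrix of a list of unit vectors, one on each of the lines. A candidate Gram matrix is a symmetric matrix over $\mathbb Q[\alpha,\beta]$ with unit diagonal and off-diagonal entries in $\{0,\pm\alpha,\pm\beta\}$, where at most two of $0,\pm\alpha,\pm\beta$ occur off the diagonal; $C_1,C_2$ are equivalent if $C_1(\alpha,\beta)=P\,C_2(\sigma(\alpha),\sigma(\beta))P^T$ for a signed permutation matrix $P$ and a permutation $\sigma$ of $\{\pm\alpha,\pm\beta\}$ with $\sigma(-\gamma)=-\sigma(\gamma)$. The system has candidate Gram matrix $C$ if one of its Gram matrices is $C(a,b)$ for some real $a,b$ with $ab(a^2-b^2)(a^2-1)(b^2-1)\ne0$. **Theorem 4.1.** The maximum cardinality of a set $X\subset\mathbb R^3$ spanning a biangular line system is $10$. The maximum configuration is unique: if $X\subset\mathbb R^3$ spans a biangular line system and $|X|=10$, then 1. some linear isometry of $\mathbb R^3$ maps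 the set of lines spanned by $X$ onto the set of main diagonals of the regular dodecahedron with vertices $(\pm1,\pm1,\pm1)$ and the cyclic shifts of $(0,\pm\varphi^{-1},\pm\varphi)$, $\varphi=(1+\sqrt5)/2$; 2. the candidate Gram matrices of order $10$ of the system are exactly those equivalent to $$C(\alpha,\beta)=\left[\begin{smallmatrix} 1 & \alpha & \alpha & \alpha & \alpha & \alpha & \alpha & \beta & \beta & \beta \\ \alpha & 1 & \alpha & -\alpha & -\alpha & \beta & -\beta & \alpha & -\alpha & \beta \\ \alpha & \alpha & 1 & \beta & -\beta & -\alpha & -\alpha & -\alpha & \alpha & \beta \\ \alpha & -\alpha & \beta & 1 & -\alpha & -\beta & \alpha & -\alpha & \beta & \alpha \\ \alpha & -\alpha & -\beta & -\alpha & 1 & \alpha & \beta & \beta & \alpha & -\alpha \\ \alpha & \beta & -\alpha & -\beta & \alpha & 1 & -\alpha & \beta & -\alpha & \alpha \\ \alpha & -\beta & -\alpha & \alpha & \beta & -\alpha & 1 & \alpha & \beta & -\alpha \\ \beta & \alpha & -\alpha & -\alpha & \beta & \beta & \alpha & 1 & \alpha & \alpha \\ \beta & -\alpha & \alpha & \beta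 & \alpha & -\alpha & \beta & \alpha & 1 & \alpha \\ \beta & \beta & \beta & \alpha & -\alpha & \alpha & -\alpha & \alpha & \alpha & 1 \end{smallmatrix}\right];$$ 3. $C(1/3,\sqrt5/3)$ is a Gram matrix of the system; 4. the absolute values of the inner products of distinct members of $X$ are exactly $1/3$ and $\sqrt5/3$. -/

import Mathlib

/-- The set `A(X)` of inner products between distinct members of `X`. -/
def innerProducts {d : ℕ} (X : Set (EuclideanSpace ℝ (Fin d))) : Set ℝ :=
  {c | ∃ x ∈ X, ∃ y ∈ X, x ≠ y ∧ c = inner ℝ x y}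

/-- A set `X` of unit vectors spans a system of `m`-angular lines: no two members are antipodal,
and the inner products of distinct members take at most `m` values up to sign. -/
def SpansMultiangularLines {d : ℕ} (m : ℕ) (X : Set (EuclideanSpace ℝ (Fin d))) : Prop :=
  (∀ x ∈ X, ‖x‖ = 1) ∧ (-1 : ℝ) ∉ innerProducts X ∧
    ((fun c : ℝ => c ^ 2) '' innerProducts X).encard ≤ m

/-- `X` spans a system of biangular lines. -/
def SpansBiangularLines {d : ℕ} (X : Set (EuclideanSpace ℝ (Fin d))) : Prop :=
  SpansMultiangularLines 2 X

/-- The lines through the origin in the directions of the members of `X`. -/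
def lineSystem {d : ℕ} (X : Set (EuclideanSpace ℝ (Fin d))) :
    Set (Submodule ℝ (EuclideanSpace ℝ (Fin d))) :=
  (fun x => Submodule.span ℝ {x}) '' X

/-- Two sets of lines through the origin are isometric: some linear isometry of the space carries
one onto the other. -/
def IsometricLines {d : ℕ} (L L' : Set (Submodule ℝ (EuclideanSpace ℝ (Fin d)))) : Prop :=
  ∃ O : EuclideanSpace ℝ (Fin d) ≃ₗᵢ[ℝ] EuclideanSpace ℝ (Fin d),
    Submodule.map (O.toLinearEquiv : EuclideanSpace ℝ (Fin d) →ₗ[ℝ] EuclideanSpace ℝ (Fin d)) '' L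
      = L'

/-- The 20 vertices of a regular dodecahedron centred at the origin: `(±1, ±1, ±1)` and the cyclic
shifts of `(0, ±φ⁻¹, ±φ)`, where `φ` is the golden ratio. The index is taken modulo 3. -/
def dodecahedronVertices : Set (EuclideanSpace ℝ (Fin 3)) :=
  {v | ∀ i, v i = 1 ∨ v i = -1} ∪
  {v | ∃ i : Fin 3, v i = 0 ∧
    (v (i + 1) = Real.goldenRatio⁻¹ ∨ v (i + 1) = -Real.goldenRatio⁻¹) ∧
    (v (i + 2) = Real.goldenRatio ∨ v (i + 2) = -Real.goldenRatio)}

/-- The main diagonals of the dodecahedron: the lines through the origin and its vertices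
(the vertex set is invariant under `v ↦ -v`). -/
def dodecahedronDiagonals : Set (Submodule ℝ (EuclideanSpace ℝ (Fin 3))) :=
  lineSystem dodecahedronVertices

/-- The polynomial ring `ℚ[α, β]`. -/
abbrev SymbolRing : Type := MvPolynomial (Fin 2) ℚ

/-- The symbol `α`. -/
noncomputable def symA : SymbolRing := MvPolynomial.X 0

/-- The symbol `β`. -/
noncomputable def symB : SymbolRing := MvPolynomial.X 1

/-- The four symbols `α, β, -α, -β`. -/
def symbolSet : Set SymbolRing := {symA, symB, -symA, -symB}

/-- `C` is a candidate Gram matrix (not normalized within its equivalence class): symmetric, with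
unit diagonal, with off-diagonal entries in `{0, ±α, ±β}`, where at most two of the three symbols
`0`, `±α`, `±β` occur off the diagonal. -/
def IsCandidateGram {n : ℕ} (C : Matrix (Fin n) (Fin n) SymbolRing) : Prop :=
  C.IsSymm ∧ (∀ i, C i i = 1) ∧ (∀ i j, i ≠ j → C i j = 0 ∨ C i j ∈ symbolSet) ∧
  ¬ ((∃ i j, i ≠ j ∧ C i j = 0) ∧
     (∃ i j, i ≠ j ∧ (C i j = symA ∨ C i j = -symA)) ∧
     (∃ i j, i ≠ j ∧ (C i j = symB ∨ C i j = -symB)))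

/-- The relabelings are the permutations `σ` of `{α, β, -α, -β}` with `σ(-γ) = -σ(γ)`; such a `σ` is
determined by `s = σ(α)` and `t = σ(β)`, which are any two symbols with `s ≠ t` and `s ≠ -t`. -/
def IsRelabeling (s t : SymbolRing) : Prop :=
  s ∈ symbolSet ∧ t ∈ symbolSet ∧ s ≠ t ∧ s ≠ -t

/-- The matrix `C(a, b)` obtained by substituting `a` for `α` and `b` for `β`. -/
noncomputable def substSymbols {R : Type} [CommRing R] [Algebra ℚ R] {n : ℕ}
    (C : Matrix (Fin n) (Fin n) SymbolRing) (a b : R) : Matrix (Fin n) (Fin n) R :=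
  C.map (MvPolynomial.aeval ![a, b])

/-- Equivalence `C₁(α, β) = P C₂(σ(α), σ(β)) Pᵀ` with a relabeling `σ` and a signed permutation
matrix `P`, whose nonzero entry in row `i` is `ε i` in column `π i`. -/
def CandidateEquiv {n : ℕ} (C₁ C₂ : Matrix (Fin n) (Fin n) SymbolRing) : Prop :=
  ∃ (π : Equiv.Perm (Fin n)) (ε : Fin n → ℤˣ) (s t : SymbolRing), IsRelabeling s t ∧
    ∀ i j, C₁ i j = ((ε i : ℤ) : SymbolRing) * ((ε j : ℤ) : SymbolRing) *
      substSymbols C₂ s t (π i) (π j)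

/-- `G` is a Gram matrix of the line system spanned by `X`: the Gram matrix of a list of unit
vectors, one on each of the lines. -/
def IsGramOfLines {d n : ℕ} (X : Set (EuclideanSpace ℝ (Fin d)))
    (G : Matrix (Fin n) (Fin n) ℝ) : Prop :=
  ∃ x : Fin n → EuclideanSpace ℝ (Fin d), (∀ i, ‖x i‖ = 1) ∧
    Function.Injective (fun i => Submodule.span ℝ {x i}) ∧
    Set.range (fun i => Submodule.span ℝ {x i}) = lineSystem X ∧
    G = Matrix.gram ℝ x

/-- `C` is a candidate Gram matrix of the line system spanned by `X`: some Gram matrix of it equals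
`C(a, b)` for real `a, b` that are nonzero, of distinct squares, and different from `±1`. -/
def HasCandidateGram {d n : ℕ} (X : Set (EuclideanSpace ℝ (Fin d)))
    (C : Matrix (Fin n) (Fin n) SymbolRing) : Prop :=
  IsCandidateGram C ∧ ∃ a b : ℝ,
    a * b * (a ^ 2 - b ^ 2) * (a ^ 2 - 1) * (b ^ 2 - 1) ≠ 0 ∧
    IsGramOfLines X (substSymbols C a b)

/-- The candidate Gram matrix of the dodecahedral line system, written with symbols `a` and `b`. -/
def dodecahedronMatrix {R : Type} [CommRing R] (a b : R) : Matrix (Fin 10) (Fin 10) R :=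
  !![1, a, a, a, a, a, a, b, b, b;
     a, 1, a, -a, -a, b, -b, a, -a, b;
     a, a, 1, b, -b, -a, -a, -a, a, b;
     a, -a, b, 1, -a, -b, a, -a, b, a;
     a, -a, -b, -a, 1, a, b, b, a, -a;
     a, b, -a, -b, a, 1, -a, b, -a, a;
     a, -b, -a, a, b, -a, 1, a, b, -a;
     b, a, -a, -a, b, b, a, 1, a, a;
     b, -a, a, b, a, -a, b, a, 1, a;
     b, b, b, a, -a, a, -a, a, a, 1]

/-- The candidate Gram matrix of the dodecahedral line system. -/
noncomputable def dodecahedronCandidate : Matrix (Fin 10) (Fin 10) SymbolRing :=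
  dodecahedronMatrix symA symB

/-! Take at least ten biangular lines in space. By Ramsey's theorem three of them are equiangular
(`exists_monochromatic_triple`), and after sign changes they carry unit vectors with a common inner
product `a`; the other cosine is `±b`. The Gram determinant of this triangle is `(1 - a)² (1 + 2a)`.
If it is nonzero, every further line is known from its inner products with the triangle, a triple
from `{±a, ±b}` up to sign. This leaves 32 triples. Unit length makes each of them a polynomial
condition on `a` and `b`, and up to signs and permutations there are ten such conditions
(`sphereEq_of_triForm`).

Ten lines need seven triples admissible for the same `a` and `b`. The types with one or three
triples exclude each other so strongly that together they supply at most six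
(`lt_seven_of_exclusions`). So the condition of one of the two types with six triples must hold.
Comparing it with the other conditions, or with the inner product of two triples that differ by a
transposition, forces `a = ±1/3` and `b² = 5/9` (`IsCodeSystem.angles`). If `a = -1/3`, three of the
remaining lines form a triangle with inner product `1/3` (`IsCodeSystem.exists_even_of_neg_third`).
If `a = 1/3`, exactly seven triples are admissible; hence there are exactly ten lines and their Gram
matrix is forced (`IsTriangulated.exists_gram_eq`).

The excluded values are treated apart and allow at most nine lines: for `a = 0` or `b = 0` the
triples are multiples of vectors with entries `0, ±1`, and for `a = -1/2` the triangle is coplanar,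
so the entries of a triple add up to zero.

The dodecahedron's diagonals have the forced Gram matrix, and this matrix determines the vectors up
to isometry. Since evaluation at the two cosines is injective on `±α, ±β`, it also determines the
candidate Gram matrix up to equivalence. -/

/-! ### Incompatibilities between the ten conditions. -/

/-- A pair of real numbers of modulus less than one and of distinct moduli, both nonzero, such that
three unit vectors with mutual inner products `a` are linearly independent. -/
structure IsAnglePair (a b : ℝ) : Prop where
  neg_one_lt : -1 < a
  lt_one : a < 1
  sq_lt_one : b ^ 2 < 1
  left_ne_zero : a ≠ 0
  right_ne_zero : b ≠ 0
  det_ne_zero : 1 + 2 * a ≠ 0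
  sq_ne_sq : a ^ 2 ≠ b ^ 2

namespace IsAnglePair

variable {a b : ℝ}

theorem neg_right (h : IsAnglePair a b) : IsAnglePair a (-b) :=
  ⟨h.1, h.2, by simpa using h.3, h.4, neg_ne_zero.2 h.5, h.6, by simpa using h.7⟩

theorem one_add_ne_zero (h : IsAnglePair a b) : 1 + a ≠ 0 := by
  have := h.neg_one_lt; intro h; linarith

theorem one_sub_ne_zero (h : IsAnglePair a b) : 1 - a ≠ 0 := by
  have := h.lt_one; intro h; linarith

theorem add_ne_zero (h : IsAnglePair a b) : a + b ≠ 0 := fun h0 =>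
  h.sq_ne_sq (by linear_combination (a - b) * h0)

theorem sub_ne_zero (h : IsAnglePair a b) : a - b ≠ 0 := fun h0 =>
  h.sq_ne_sq (by linear_combination (a + b) * h0)

theorem right_ne_one (h : IsAnglePair a b) : b - 1 ≠ 0 := fun h0 => by
  have := h.sq_lt_one
  rw [show b = 1 by linarith] at this
  norm_num at this

end IsAnglePair

/-- The ten conditions under which a unit vector may have prescribed inner products from
`{±a, ±b}` with the members of a triple of unit vectors with mutual inner products `a`. -/
def SphereEq (a b : ℝ) : Fin 10 → Prop := ![
  3 * a = -1,
  5 * a ^ 2 = 1,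
  (1 + a) * (1 + b) = 4 * a ^ 2,
  (1 + a) * (1 - b) = 4 * a ^ 2,
  b ^ 2 = 1 - 4 * a ^ 2,
  2 * b ^ 2 - 4 * a ^ 2 * b + a ^ 3 + 3 * a ^ 2 - a - 1 = 0,
  2 * b ^ 2 + 4 * a ^ 2 * b + a ^ 3 + 3 * a ^ 2 - a - 1 = 0,
  2 * (1 + 2 * a) * b ^ 2 = 1 + a - 3 * a ^ 2 - a ^ 3,
  3 * b ^ 2 = 1 + 2 * a,
  b ^ 2 * (3 + 5 * a) = (1 - a) * (1 + 2 * a)]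

section Exclusions

variable {a b : ℝ}

theorem ne_of_sq_fifth (h : IsAnglePair a b) (h5 : a ^ 2 = 1 / 5)
    (h3 : (1 + a) * (1 + b) = 4 * a ^ 2) : False := by
  have : (1 + a) * (a + b) = 0 := by linear_combination h3 + 5 * h5
  rcases mul_eq_zero.1 this with h0 | h0
  · exact h.one_add_ne_zero h0
  · exact h.add_ne_zero h0

theorem not_three_zero (h : IsAnglePair a b) (h1 : 3 * a = -1)
    (h3 : (1 + a) * (1 + b) = 4 * a ^ 2) : False := by
  obtain rfl : a = -1 / 3 := by linarith
  exact h.sub_ne_zero (by linarith)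

/-- From here to the end of the section, `h1`, ..., `h10` stand for the conditions of `SphereEq`
counted from one, while its index starts at zero. -/
theorem not_two_ten (h : IsAnglePair a b) (h2 : 5 * a ^ 2 = 1)
    (h10 : b ^ 2 * (3 + 5 * a) = (1 - a) * (1 + 2 * a)) : False := by
  have e : (3 + 5 * a) * (b ^ 2 - a ^ 2) = 0 := by
    linear_combination h10 - (a + 1) * h2
  rcases mul_eq_zero.1 e with h0 | h0
  · rw [show a = -3 / 5 by linarith] at h2
    norm_num at h2
  · exact h.sq_ne_sq (by linarith)

/-- The factor `5a² - 1` recurs below: together with `b² = 1 - 4a²` its vanishing gives `b² = 1/5 =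
a²`, which is excluded. -/
theorem not_five_three (h : IsAnglePair a b) (h5 : b ^ 2 = 1 - 4 * a ^ 2)
    (h3 : (1 + a) * (1 + b) = 4 * a ^ 2) : False := by
  have e : a ^ 2 * (5 * a ^ 2 - 1) = 0 := by
    linear_combination (1 / 4) * (1 + a) ^ 2 * h5
      - (1 / 4) * ((1 + a) * b - (1 + a) + 4 * a ^ 2) * h3
  rcases mul_eq_zero.1 e with h0 | h0
  · exact h.left_ne_zero (by simpa using h0)
  · exact h.sq_ne_sq (by linarith)

theorem not_five_ten (h : IsAnglePair a b) (h5 : b ^ 2 = 1 - 4 * a ^ 2)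
    (h10 : b ^ 2 * (3 + 5 * a) = (1 - a) * (1 + 2 * a)) : False := by
  have e : (1 + 2 * a) * (5 * a ^ 2 - 1) = 0 := by
    linear_combination (1 / 2) * (3 + 5 * a) * h5 - (1 / 2) * h10
  rcases mul_eq_zero.1 e with h0 | h0
  · exact h.det_ne_zero h0
  · exact h.sq_ne_sq (by linarith)

theorem good_of_five_eight (h : IsAnglePair a b) (h5 : b ^ 2 = 1 - 4 * a ^ 2)
    (h8 : 2 * (1 + 2 * a) * b ^ 2 = 1 + a - 3 * a ^ 2 - a ^ 3) : 3 * a = -1 := by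
  have e : (1 + 3 * a) * (5 * a ^ 2 - 1) = 0 := by
    linear_combination 2 * (1 + 2 * a) * h5 - h8
  rcases mul_eq_zero.1 e with h0 | h0
  · linarith
  · exact absurd (by linarith) h.sq_ne_sq

theorem good_of_five_nine (h : IsAnglePair a b) (h5 : b ^ 2 = 1 - 4 * a ^ 2)
    (h9 : 3 * b ^ 2 = 1 + 2 * a) : 3 * a = 1 := by
  have e : (1 + 2 * a) * (3 * a - 1) = 0 := by
    linear_combination (3 / 2) * h5 - (1 / 2) * h9
  rcases mul_eq_zero.1 e with h0 | h0
  · exact absurd h0 h.det_ne_zero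
  · linarith

/-- Here `g` is the inner product of the vectors with coordinates `(a, -a, b)` and `(-a, a, b)`. -/
theorem good_of_five_swap (h : IsAnglePair a b) (h5 : b ^ 2 = 1 - 4 * a ^ 2) {g : ℝ}
    (hg : (1 - a) * (1 - g) = 4 * a ^ 2) (hg2 : g ^ 2 = a ^ 2 ∨ g ^ 2 = b ^ 2) : 3 * a = 1 := by
  rcases hg2 with h0 | h0
  · rcases sq_eq_sq_iff_eq_or_eq_neg.1 h0 with e | e
    · have e : (1 + a) * (3 * a - 1) = 0 := by rw [e] at hg; linear_combination -hg
      rcases mul_eq_zero.1 e with h0 | h0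
      · exact absurd h0 h.one_add_ne_zero
      · linarith
    · rw [e] at hg
      exact absurd (by linarith) h.sq_ne_sq
  · have e : a ^ 2 * (5 * a ^ 2 - 1) = 0 := by
      linear_combination (1 / 4) * (1 - a) ^ 2 * (h0 + h5)
        + (1 / 4) * (1 - a - 4 * a ^ 2 + (1 - a) * g) * hg
    rcases mul_eq_zero.1 e with h0 | h0
    · exact absurd (by simpa using h0) h.left_ne_zero
    · exact absurd (by linarith) h.sq_ne_sq

theorem not_six_eight (h : IsAnglePair a b)
    (h6 : 2 * b ^ 2 - 4 * a ^ 2 * b + a ^ 3 + 3 * a ^ 2 - a - 1 = 0)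
    (h8 : 2 * (1 + 2 * a) * b ^ 2 = 1 + a - 3 * a ^ 2 - a ^ 3) : False := by
  have e : a * b * (a + b) = 0 := by linear_combination (1 / 4) * (h8 - h6)
  exact mul_ne_zero (mul_ne_zero h.left_ne_zero h.right_ne_zero) h.add_ne_zero e

theorem not_eight_ten (h : IsAnglePair a b)
    (h8 : 2 * (1 + 2 * a) * b ^ 2 = 1 + a - 3 * a ^ 2 - a ^ 3)
    (h10 : b ^ 2 * (3 + 5 * a) = (1 - a) * (1 + 2 * a)) : False := by
  have e : (1 + a) ^ 2 * (5 * a ^ 2 - 1) = 0 := by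
    linear_combination (3 + 5 * a) * h8 - 2 * (1 + 2 * a) * h10
  rcases mul_eq_zero.1 e with h0 | h0
  · exact pow_ne_zero 2 h.one_add_ne_zero h0
  · refine not_two_ten h (by linarith) h10

theorem not_six_seven (h : IsAnglePair a b)
    (h6 : 2 * b ^ 2 - 4 * a ^ 2 * b + a ^ 3 + 3 * a ^ 2 - a - 1 = 0)
    (h7 : 2 * b ^ 2 + 4 * a ^ 2 * b + a ^ 3 + 3 * a ^ 2 - a - 1 = 0) : False := by
  have e : a ^ 2 * b = 0 := by linear_combination (1 / 8) * (h7 - h6)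
  exact mul_ne_zero (pow_ne_zero 2 h.left_ne_zero) h.right_ne_zero e

theorem not_nine_ten (h : IsAnglePair a b) (h9 : 3 * b ^ 2 = 1 + 2 * a)
    (h10 : b ^ 2 * (3 + 5 * a) = (1 - a) * (1 + 2 * a)) : False := by
  have e : a * (1 + 2 * a) = 0 := by
    linear_combination (3 / 8) * h10 - (1 / 8) * (3 + 5 * a) * h9
  exact mul_ne_zero h.left_ne_zero h.det_ne_zero e

theorem not_two_six_nine (h : IsAnglePair a b) (h2 : 5 * a ^ 2 = 1)
    (h6 : 2 * b ^ 2 - 4 * a ^ 2 * b + a ^ 3 + 3 * a ^ 2 - a - 1 = 0)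
    (h9 : 3 * b ^ 2 = 1 + 2 * a) : False := by
  have e : b * (b - 1) = 0 := by
    linear_combination (5 / 4) * h6 - (1 / 2) * h9 + (b - (1 / 4) * a - 3 / 4) * h2
  exact mul_ne_zero h.right_ne_zero h.right_ne_one e

theorem not_one_six_ten (h1 : 3 * a = -1)
    (h6 : 2 * b ^ 2 - 4 * a ^ 2 * b + a ^ 3 + 3 * a ^ 2 - a - 1 = 0)
    (h10 : b ^ 2 * (3 + 5 * a) = (1 - a) * (1 + 2 * a)) : False := by
  obtain rfl : a = -1 / 3 := by linarith
  have hb : b ^ 2 = 1 / 3 := by linarith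
  have : b = 2 / 3 := by linarith
  rw [this] at hb
  norm_num at hb

theorem not_two_eight (h : IsAnglePair a b) (h2 : 5 * a ^ 2 = 1)
    (h8 : 2 * (1 + 2 * a) * b ^ 2 = 1 + a - 3 * a ^ 2 - a ^ 3) : False := by
  have e : (1 + 2 * a) * (b ^ 2 - a ^ 2) = 0 := by
    linear_combination (1 / 2) * h8 - (1 / 2) * (1 + a) * h2
  rcases mul_eq_zero.1 e with h0 | h0
  · exact h.det_ne_zero h0
  · exact h.sq_ne_sq (by linarith)

/-- Condition `h3` is linear in `b`, namely `(1 + a) b = 4a² - a - 1`. Multiplying the other two by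
`(1 + a)²` eliminates `b`, and the resulting polynomials in `a` have only the common roots `1` and
`-1/3`. -/
theorem not_three_six_nine (h : IsAnglePair a b) (h3 : (1 + a) * (1 + b) = 4 * a ^ 2)
    (h6 : 2 * b ^ 2 - 4 * a ^ 2 * b + a ^ 3 + 3 * a ^ 2 - a - 1 = 0)
    (h9 : 3 * b ^ 2 = 1 + 2 * a) :
    False := by
  have A : 48 * a ^ 4 - 26 * a ^ 3 - 26 * a ^ 2 + 2 * a + 2 = 0 := by
    linear_combination (1 + a) ^ 2 * h9 - 3 * (4 * a ^ 2 - a - 1 + (1 + a) * b) * h3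
  have B : -15 * a ^ 5 + 25 * a ^ 4 - 2 * a ^ 3 - 10 * a ^ 2 + a + 1 = 0 := by
    linear_combination (1 + a) ^ 2 * h6 - (2 * (4 * a ^ 2 - a - 1 + (1 + a) * b) - 4 * a ^ 2 * (1 + a)) * h3
  have e : (1 - a) * (3 * a + 1) = 0 := by
    linear_combination -3 * (35 / 64 * a ^ 2 - 25 / 24 * a + 33 / 64) * A
      - 3 * (7 / 4 * a - 131 / 96) * B
  rcases mul_eq_zero.1 e with h0 | h0
  · exact h.one_sub_ne_zero h0
  · exact not_three_zero h (by linarith) h3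

theorem not_three_seven_nine (h3 : (1 + a) * (1 + b) = 4 * a ^ 2)
    (h7 : 2 * b ^ 2 + 4 * a ^ 2 * b + a ^ 3 + 3 * a ^ 2 - a - 1 = 0)
    (h9 : 3 * b ^ 2 = 1 + 2 * a) :
    False := by
  have A : 48 * a ^ 4 - 26 * a ^ 3 - 26 * a ^ 2 + 2 * a + 2 = 0 := by
    linear_combination (1 + a) ^ 2 * h9 - 3 * (4 * a ^ 2 - a - 1 + (1 + a) * b) * h3
  have B : 17 * a ^ 5 + 49 * a ^ 4 - 18 * a ^ 3 - 18 * a ^ 2 + a + 1 = 0 := by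
    linear_combination (1 + a) ^ 2 * h7 - (2 * (4 * a ^ 2 - a - 1 + (1 + a) * b) + 4 * a ^ 2 * (1 + a)) * h3
  -- A Bézout identity: `A` and `B` are coprime polynomials in `a`, and the coefficients are
  -- cofactors of their gcd.
  have e : (1 : ℝ) = 0 := by
    linear_combination (28937 / 256 * a ^ 4 + 607067 / 2176 * a ^ 3 - 16095 / 68 * a ^ 2 - 56099 / 2176 * a + 81511 / 4352) * A
      + (-86811 / 272 * a ^ 3 + 663869 / 2176 * a ^ 2 + 55011 / 1088 * a - 79335 / 2176) * B
  exact one_ne_zero e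

theorem not_three_six_ten (h : IsAnglePair a b) (h3 : (1 + a) * (1 + b) = 4 * a ^ 2)
    (h6 : 2 * b ^ 2 - 4 * a ^ 2 * b + a ^ 3 + 3 * a ^ 2 - a - 1 = 0)
    (h10 : b ^ 2 * (3 + 5 * a) = (1 - a) * (1 + 2 * a)) :
    False := by
  have A : 80 * a ^ 5 + 10 * a ^ 4 - 56 * a ^ 3 - 12 * a ^ 2 + 8 * a + 2 = 0 := by
    linear_combination (1 + a) ^ 2 * h10 - (3 + 5 * a) * (4 * a ^ 2 - a - 1 + (1 + a) * b) * h3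
  have B : -15 * a ^ 5 + 25 * a ^ 4 - 2 * a ^ 3 - 10 * a ^ 2 + a + 1 = 0 := by
    linear_combination (1 + a) ^ 2 * h6 - (2 * (4 * a ^ 2 - a - 1 + (1 + a) * b) - 4 * a ^ 2 * (1 + a)) * h3
  exact ne_of_sq_fifth h (by
    linear_combination (21 / 80 * a ^ 2 - 53 / 80 * a + 17 / 40) * A
      + (7 / 5 * a ^ 2 - 41 / 40 * a - 21 / 20) * B) h3

theorem not_three_seven_ten (h3 : (1 + a) * (1 + b) = 4 * a ^ 2)
    (h7 : 2 * b ^ 2 + 4 * a ^ 2 * b + a ^ 3 + 3 * a ^ 2 - a - 1 = 0)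
    (h10 : b ^ 2 * (3 + 5 * a) = (1 - a) * (1 + 2 * a)) :
    False := by
  have A : 80 * a ^ 5 + 10 * a ^ 4 - 56 * a ^ 3 - 12 * a ^ 2 + 8 * a + 2 = 0 := by
    linear_combination (1 + a) ^ 2 * h10 - (3 + 5 * a) * (4 * a ^ 2 - a - 1 + (1 + a) * b) * h3
  have B : 17 * a ^ 5 + 49 * a ^ 4 - 18 * a ^ 3 - 18 * a ^ 2 + a + 1 = 0 := by
    linear_combination (1 + a) ^ 2 * h7 - (2 * (4 * a ^ 2 - a - 1 + (1 + a) * b) + 4 * a ^ 2 * (1 + a)) * h3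
  have e : (1 : ℝ) = 0 := by
    linear_combination (-939505 / 512 * a ^ 4 - 1227895 / 256 * a ^ 3 + 413553 / 128 * a ^ 2 + 275495 / 256 * a - 204387 / 512) * A
      + (276325 / 32 * a ^ 4 - 317075 / 256 * a ^ 3 - 1462835 / 256 * a ^ 2 + 61915 / 256 * a + 204643 / 256) * B
  exact one_ne_zero e

theorem not_three_eight_nine (h3 : (1 + a) * (1 + b) = 4 * a ^ 2)
    (h8 : 2 * (1 + 2 * a) * b ^ 2 = 1 + a - 3 * a ^ 2 - a ^ 3)
    (h9 : 3 * b ^ 2 = 1 + 2 * a) :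
    False := by
  have A : 48 * a ^ 4 - 26 * a ^ 3 - 26 * a ^ 2 + 2 * a + 2 = 0 := by
    linear_combination (1 + a) ^ 2 * h9 - 3 * (4 * a ^ 2 - a - 1 + (1 + a) * b) * h3
  have B : 3 * a ^ 3 + 17 * a ^ 2 + 5 * a - 1 = 0 := by
    linear_combination 3 * h8 - 2 * (1 + 2 * a) * h9
  have e : (1 : ℝ) = 0 := by
    linear_combination (-3109 / 2624 * a ^ 2 - 746 / 123 * a + 11171 / 7872) * A
      + (3109 / 164 * a ^ 3 - 81289 / 3936 * a ^ 2 - 199 / 1968 * a + 7235 / 3936) * B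
  exact one_ne_zero e

/-- Condition `h9` gives `b²` in terms of `a`, so `A` is a cubic in `a` alone. Each of `g = a`, `g =
-a`, `g² = b²` yields a second polynomial coprime to it. -/
theorem not_eight_nine_of_swap (h8 : 2 * (1 + 2 * a) * b ^ 2 = 1 + a - 3 * a ^ 2 - a ^ 3)
    (h9 : 3 * b ^ 2 = 1 + 2 * a) {g : ℝ} (hg : (1 - a) * (1 - g) = 4 * b ^ 2)
    (hg2 : g ^ 2 = a ^ 2 ∨ g ^ 2 = b ^ 2) : False := by
  have A : 3 * a ^ 3 + 17 * a ^ 2 + 5 * a - 1 = 0 := by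
    linear_combination 3 * h8 - 2 * (1 + 2 * a) * h9
  rcases hg2 with h0 | h0
  · rcases sq_eq_sq_iff_eq_or_eq_neg.1 h0 with e | e
    · rw [e] at hg
      have B : a ^ 2 - 14 / 3 * a - 1 / 3 = 0 := by
        linear_combination hg + 4 / 3 * h9
      have e : (1 : ℝ) = 0 := by
        linear_combination (113 / 688 * a - 1603 / 2064) * A
          + (-339 / 688 * a ^ 2 - 475 / 172 * a - 461 / 688) * B
      exact one_ne_zero e
    · rw [e] at hg
      have B : -a ^ 2 - 8 / 3 * a - 1 / 3 = 0 := by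
        linear_combination hg + 4 / 3 * h9
      have e : (1 : ℝ) = 0 := by
        linear_combination (-5 / 16 * a - 37 / 48) * A
          + (-15 / 16 * a ^ 2 - 41 / 8 * a - 11 / 16) * B
      exact one_ne_zero e
  · have B : -2 / 3 * a ^ 3 + 130 / 9 * a ^ 2 + 22 / 9 * a - 2 / 9 = 0 := by
      linear_combination (1 - a) ^ 2 * (h0 + 1 / 3 * h9)
        + (1 - a - 4 / 3 * (1 + 2 * a) + (1 - a) * g) * (hg + 4 / 3 * h9)
    have e : (1 : ℝ) = 0 := by
      linear_combination (131 / 944 * a ^ 2 - 8389 / 2832 * a - 2093 / 1416) * A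
        + (1179 / 1888 * a ^ 2 + 7059 / 1888 * a + 2031 / 944) * B
    exact one_ne_zero e

/-- Again `h3` eliminates `b`. For `g = a` and `g = -b` the two polynomials in `a` are coprime; for
`g = -a` and `g = b` they force `a² = 1/5`, contrary to `h3`. -/
theorem not_three_eight_of_swap (h : IsAnglePair a b) (h3 : (1 + a) * (1 + b) = 4 * a ^ 2)
    (h8 : 2 * (1 + 2 * a) * b ^ 2 = 1 + a - 3 * a ^ 2 - a ^ 3) {g : ℝ} (hg : (1 - a) * (1 - g) = 4 * b ^ 2)
    (hg2 : g ^ 2 = a ^ 2 ∨ g ^ 2 = b ^ 2) : False := by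
  have A : 65 * a ^ 5 + 5 * a ^ 4 - 38 * a ^ 3 - 6 * a ^ 2 + 5 * a + 1 = 0 := by
    linear_combination (1 + a) ^ 2 * h8 - 2 * (1 + 2 * a) * (4 * a ^ 2 - a - 1 + (1 + a) * b) * h3
  rcases hg2 with h0 | h0
  · rcases sq_eq_sq_iff_eq_or_eq_neg.1 h0 with e | e
    · rw [e] at hg
      have B : -63 * a ^ 4 + 32 * a ^ 3 + 26 * a ^ 2 - 8 * a - 3 = 0 := by
        linear_combination (1 + a) ^ 2 * hg + 4 * (4 * a ^ 2 - a - 1 + (1 + a) * b) * h3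
      have e : (1 : ℝ) = 0 := by
        linear_combination (-46431 / 256 * a ^ 3 + 48217 / 256 * a ^ 2 - 469 / 256 * a - 6965 / 256) * A
          + (-47905 / 256 * a ^ 4 + 10865 / 128 * a ^ 3 + 2827 / 32 * a ^ 2 - 2673 / 128 * a - 2407 / 256) * B
      exact one_ne_zero e
    · rw [e] at hg
      have B : -65 * a ^ 4 + 30 * a ^ 3 + 28 * a ^ 2 - 6 * a - 3 = 0 := by
        linear_combination (1 + a) ^ 2 * hg + 4 * (4 * a ^ 2 - a - 1 + (1 + a) * b) * h3
      exact ne_of_sq_fifth h (by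
        linear_combination (-13 / 20 * a + 5 / 8) * A
          + (-13 / 20 * a ^ 2 + 11 / 40 * a + 11 / 40) * B) h3
  · rcases sq_eq_sq_iff_eq_or_eq_neg.1 h0 with e | e
    · rw [e] at hg
      have B : -60 * a ^ 4 + 30 * a ^ 3 + 22 * a ^ 2 - 6 * a - 2 = 0 := by
        linear_combination (1 + a) ^ 2 * hg + 4 * (4 * a ^ 2 - a - 1 + (1 + a) * b) * h3 + (1 - a) * (1 + a) * h3
      exact ne_of_sq_fifth h (by
        linear_combination (-99 / 20 * a + 153 / 40) * A
          + (-429 / 80 * a ^ 2 + 21 / 20 * a + 161 / 80) * B) h3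
    · rw [e] at hg
      have B : -68 * a ^ 4 + 32 * a ^ 3 + 32 * a ^ 2 - 8 * a - 4 = 0 := by
        linear_combination (1 + a) ^ 2 * hg + 4 * (4 * a ^ 2 - a - 1 + (1 + a) * b) * h3 - (1 - a) * (1 + a) * h3
      have e : (1 : ℝ) = 0 := by
        linear_combination (-84473 / 448 * a ^ 3 + 11743 / 64 * a ^ 2 + 3303 / 448 * a - 12897 / 448) * A
          + (-322985 / 1792 * a ^ 4 + 34365 / 448 * a ^ 3 + 69161 / 896 * a ^ 2 - 8623 / 448 * a - 13345 / 1792) * B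
      exact one_ne_zero e

end Exclusions

/-! ### Encoding lines by triples of symbols. -/

/-- The symbols `a, b, -a, -b`, numbered so that adding `2` is negation. -/
def symVal (a b : ℝ) : Fin 4 → ℝ := ![a, b, -a, -b]

theorem symVal_add_two (a b : ℝ) (s : Fin 4) : symVal a b (s + 2) = -symVal a b s := by
  fin_cases s <;> simp [symVal]

/-- The triples of symbols up to sign, sorted by their type. -/
def code : Fin 32 → Fin 3 → Fin 4 := ![
  ![0, 0, 0],
  ![2, 0, 0], ![0, 2, 0], ![0, 0, 2],
  ![0, 0, 1], ![0, 1, 0], ![1, 0, 0],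
  ![0, 0, 3], ![0, 3, 0], ![3, 0, 0],
  ![0, 2, 1], ![1, 0, 2], ![2, 1, 0], ![2, 0, 1], ![1, 2, 0], ![0, 1, 2],
  ![0, 1, 1], ![1, 0, 1], ![1, 1, 0],
  ![0, 3, 3], ![3, 0, 3], ![3, 3, 0],
  ![1, 3, 0], ![0, 1, 3], ![3, 0, 1], ![3, 1, 0], ![0, 3, 1], ![1, 0, 3],
  ![1, 1, 1],
  ![3, 1, 1], ![1, 3, 1], ![1, 1, 3]]

/-- The type of a triple of symbols, that is, its orbit under signs and permutations. -/
def codeType : Fin 32 → Fin 10 := ![0, 1, 1, 1, 2, 2, 2, 3, 3, 3, 4, 4, 4, 4, 4, 4, 5, 5, 5, 6, 6, 6,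
  7, 7, 7, 7, 7, 7, 8, 9, 9, 9]

set_option maxRecDepth 100000 in
theorem exists_code (c : Fin 3 → Fin 4) :
    ∃ m, (∀ r, code m r = c r) ∨ ∀ r, code m r = c r + 2 := by
  revert c; decide

/-- The inner product, up to the factor `(1 - a) * (1 + 2 * a)`, of the vectors having coordinates
`v` and `w` with respect to three unit vectors with mutual inner products `a`. -/
def triForm (a : ℝ) (v w : Fin 3 → ℝ) : ℝ :=
  (1 + 2 * a) * (v 0 * w 0 + v 1 * w 1 + v 2 * w 2) -
    a * ((v 0 + v 1 + v 2) * (w 0 + w 1 + w 2))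

/-- The coordinates encoded by a triple of symbols. -/
def codeVec (a b : ℝ) (m : Fin 32) : Fin 3 → ℝ := fun r => symVal a b (code m r)

/-- Up to order of terms, `key` is the unit-length equation in factored form. The factors `1 - a`,
`1 + a`, `b - 1`, `b + 1` cannot vanish and are cancelled. -/
theorem sphereEq_of_triForm {a b : ℝ} (h : IsAnglePair a b) {m : Fin 32}
    (hm : triForm a (codeVec a b m) (codeVec a b m) = (1 - a) * (1 + 2 * a)) :
    SphereEq a b (codeType m) := by
  have key : ![(a - 1) ^ 2 * (-(3 * a) - 1), (a + 1) * (5 * a ^ 2 - 1),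
      (b - 1) * ((1 + a) * (1 + b) - 4 * a ^ 2), (b + 1) * (4 * a ^ 2 - (1 + a) * (1 - b)),
      (1 + a) * (b ^ 2 + 4 * a ^ 2 - 1),
      2 * b ^ 2 - 4 * a ^ 2 * b + a ^ 3 + 3 * a ^ 2 - a - 1,
      2 * b ^ 2 + 4 * a ^ 2 * b + a ^ 3 + 3 * a ^ 2 - a - 1,
      2 * (1 + 2 * a) * b ^ 2 - 1 - a + 3 * a ^ 2 + a ^ 3,
      (1 - a) * (3 * b ^ 2 - 1 - 2 * a),
      b ^ 2 * (3 + 5 * a) - (1 - a) * (1 + 2 * a)] (codeType m) = 0 := by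
    simp only [triForm, codeVec] at hm
    fin_cases m <;> simp [code, symVal, codeType, -mul_eq_zero] at hm ⊢ <;> linear_combination hm
  have hb : b + 1 ≠ 0 := by simpa using h.neg_right.right_ne_one ∘ fun e => by linarith
  generalize codeType m = t at key ⊢
  fin_cases t <;> simp [SphereEq, -mul_eq_zero] at key ⊢
  · have := (mul_eq_zero.1 key).resolve_left (pow_ne_zero 2 (sub_ne_zero.2 h.lt_one.ne))
    linarith
  · have := (mul_eq_zero.1 key).resolve_left (by rw [add_comm]; exact h.one_add_ne_zero)
    linarith
  · have := (mul_eq_zero.1 key).resolve_left h.right_ne_one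
    linarith
  · have := (mul_eq_zero.1 key).resolve_left hb
    linarith
  · have := (mul_eq_zero.1 key).resolve_left h.one_add_ne_zero
    linarith
  · exact key
  · exact key
  · linarith
  · have := (mul_eq_zero.1 key).resolve_left h.one_sub_ne_zero
    linarith
  · linarith

theorem IsAnglePair.one_sub_mul_ne_zero {a b : ℝ} (h : IsAnglePair a b) :
    (1 - a) * (1 + 2 * a) ≠ 0 :=
  mul_ne_zero h.one_sub_ne_zero h.det_ne_zero

/-- A set of triples of symbols that are the coordinates of unit vectors, whose inner products
all have modulus `|a|` or `|b|`. -/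
structure IsCodeSystem (a b : ℝ) (U : Finset (Fin 32)) : Prop where
  pair : IsAnglePair a b
  unit : ∀ m ∈ U,
    triForm a (codeVec a b m) (codeVec a b m) = (1 - a) * (1 + 2 * a)
  inner : ∀ m ∈ U, ∀ m' ∈ U, m ≠ m' → ∃ g : ℝ,
    (1 - a) * (1 + 2 * a) * g = triForm a (codeVec a b m) (codeVec a b m') ∧
      (g ^ 2 = a ^ 2 ∨ g ^ 2 = b ^ 2)

namespace IsCodeSystem

variable {a b : ℝ} {U : Finset (Fin 32)}

theorem sphereEq (hU : IsCodeSystem a b U) {m : Fin 32} (hm : m ∈ U) :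
    SphereEq a b (codeType m) :=
  sphereEq_of_triForm hU.pair (hU.unit m hm)

/-- Polarization of the inner products. -/
theorem exists_inner (hU : IsCodeSystem a b U) {m m' : Fin 32} (hm : m ∈ U) (hm' : m' ∈ U)
    (hne : m ≠ m') (hs : codeVec a b m 0 + codeVec a b m 1 + codeVec a b m 2 =
      codeVec a b m' 0 + codeVec a b m' 1 + codeVec a b m' 2) :
    ∃ g : ℝ, 2 * ((1 - a) * (1 - g)) = (codeVec a b m 0 - codeVec a b m' 0) ^ 2 +
      (codeVec a b m 1 - codeVec a b m' 1) ^ 2 + (codeVec a b m 2 - codeVec a b m' 2) ^ 2 ∧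
      (g ^ 2 = a ^ 2 ∨ g ^ 2 = b ^ 2) := by
  obtain ⟨g, hg, hg2⟩ := hU.inner m hm m' hm' hne
  -- Equal coordinate sums make the rank-one term of `triForm` cancel in the squared distance,
  -- leaving `1 + 2a` as a common factor.
  refine ⟨g, mul_left_cancel₀ hU.pair.det_ne_zero ?_, hg2⟩
  have e := hU.unit m hm
  have e' := hU.unit m' hm'
  simp only [triForm] at hg e e'
  rw [hs] at hg e
  linear_combination -2 * hg - e - e'

/-- Each pair consists of triples with entries `a, -a, b` that differ by exchanging `a` and `-a`;
their squared coordinate distance is `8a²`. -/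
theorem five_swap (hU : IsCodeSystem a b U) {m m' : Fin 32} (hm : m ∈ U) (hm' : m' ∈ U)
    (h : (m = 10 ∧ m' = 13) ∨ (m = 11 ∧ m' = 14) ∨ (m = 12 ∧ m' = 15)) :
    ∃ g : ℝ, (1 - a) * (1 - g) = 4 * a ^ 2 ∧ (g ^ 2 = a ^ 2 ∨ g ^ 2 = b ^ 2) := by
  obtain ⟨g, hg, hg2⟩ := hU.exists_inner hm hm' (by rintro rfl; omega) (by
    rcases h with ⟨rfl, rfl⟩ | ⟨rfl, rfl⟩ | ⟨rfl, rfl⟩ <;> simp [codeVec, code, symVal])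
  refine ⟨g, ?_, hg2⟩
  rcases h with ⟨rfl, rfl⟩ | ⟨rfl, rfl⟩ | ⟨rfl, rfl⟩ <;> simp [codeVec, code, symVal] at hg <;>
    linear_combination (1 / 2) * hg

theorem eight_swap (hU : IsCodeSystem a b U) {m m' : Fin 32} (hm : m ∈ U) (hm' : m' ∈ U)
    (h : (m = 22 ∧ m' = 25) ∨ (m = 23 ∧ m' = 26) ∨ (m = 24 ∧ m' = 27)) :
    ∃ g : ℝ, (1 - a) * (1 - g) = 4 * b ^ 2 ∧ (g ^ 2 = a ^ 2 ∨ g ^ 2 = b ^ 2) := by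
  obtain ⟨g, hg, hg2⟩ := hU.exists_inner hm hm' (by rintro rfl; omega) (by
    rcases h with ⟨rfl, rfl⟩ | ⟨rfl, rfl⟩ | ⟨rfl, rfl⟩ <;> simp [codeVec, code, symVal])
  refine ⟨g, ?_, hg2⟩
  rcases h with ⟨rfl, rfl⟩ | ⟨rfl, rfl⟩ | ⟨rfl, rfl⟩ <;> simp [codeVec, code, symVal] at hg <;>
    linear_combination (1 / 2) * hg

/-- Pigeonhole for three pairs: triples of a six-element type that differ by a swap have numbers
differing by `3`. -/
theorem exists_pair_of_card {V : Finset (Fin 32)} {i : Fin 32} {W : Finset (Fin 32)}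
    (hW : ∀ m ∈ W, m = i ∨ m = i + 1 ∨ m = i + 2 ∨ m = i + 3 ∨ m = i + 4 ∨ m = i + 5)
    (hV : V ⊆ W) (hc : 4 ≤ V.card) :
    (i ∈ V ∧ i + 3 ∈ V) ∨ (i + 1 ∈ V ∧ i + 4 ∈ V) ∨ (i + 2 ∈ V ∧ i + 5 ∈ V) := by
  by_contra! h
  obtain ⟨h1, h2, h3⟩ := h
  have : V ⊆ {if i ∈ V then i else i + 3, if i + 1 ∈ V then i + 1 else i + 4,
      if i + 2 ∈ V then i + 2 else i + 5} := by
    intro m hm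
    simp only [Finset.mem_insert, Finset.mem_singleton]
    rcases hW m (hV hm) with rfl | rfl | rfl | rfl | rfl | rfl
    · simp [hm]
    · simp [hm]
    · simp [hm]
    · rw [if_neg (fun h => h1 h hm)]; simp
    · rw [if_neg (fun h => h2 h hm)]; simp
    · rw [if_neg (fun h => h3 h hm)]; simp
  have := (Finset.card_le_card this).trans Finset.card_le_three
  omega

end IsCodeSystem

/-! ### Counting triples by type. -/

namespace IsCodeSystem

variable {a b : ℝ} {U : Finset (Fin 32)}

/-- The type statistics of a system of triples. -/
structure IsTypeCount (a b : ℝ) (n : Fin 10 → ℕ) : Prop where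
  le : ∀ t, n t ≤ ![1, 3, 3, 3, 6, 3, 3, 6, 1, 3] t
  sphereEq : ∀ t, n t ≠ 0 → SphereEq a b t
  five : 4 ≤ n 4 → ∃ g : ℝ, (1 - a) * (1 - g) = 4 * a ^ 2 ∧ (g ^ 2 = a ^ 2 ∨ g ^ 2 = b ^ 2)
  eight : 4 ≤ n 7 → ∃ g : ℝ, (1 - a) * (1 - g) = 4 * b ^ 2 ∧ (g ^ 2 = a ^ 2 ∨ g ^ 2 = b ^ 2)

theorem card_eq_sum (U : Finset (Fin 32)) {n : Fin 10 → ℕ}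
    (hn : ∀ t, n t = (U.filter (codeType · = t)).card) :
    U.card = n 0 + n 1 + n 2 + n 3 + n 4 + n 5 + n 6 + n 7 + n 8 + n 9 := by
  rw [Finset.card_eq_sum_card_fiberwise (f := codeType) (t := Finset.univ) (by simp)]
  simp [Fin.sum_univ_succ, hn, add_assoc]

theorem isTypeCount (hU : IsCodeSystem a b U) {n : Fin 10 → ℕ}
    (hn : ∀ t, n t = (U.filter (codeType · = t)).card) : IsTypeCount a b n := by
  have hle (t : Fin 10) : n t ≤ ![1, 3, 3, 3, 6, 3, 3, 6, 1, 3] t := by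
    rw [hn]
    refine (Finset.card_le_card (Finset.filter_subset_filter _ (Finset.subset_univ U))).trans ?_
    revert t; decide
  have hE (t : Fin 10) (ht : n t ≠ 0) : SphereEq a b t := by
    rw [hn] at ht
    obtain ⟨m, hm⟩ := Finset.card_ne_zero.1 ht
    rw [Finset.mem_filter] at hm
    exact hm.2 ▸ hU.sphereEq hm.1
  have s5 (ht : 4 ≤ n 4) :
      ∃ g : ℝ, (1 - a) * (1 - g) = 4 * a ^ 2 ∧ (g ^ 2 = a ^ 2 ∨ g ^ 2 = b ^ 2) := by
    have := exists_pair_of_card (i := 10) (W := Finset.univ.filter (codeType · = 4)) (by decide)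
      (Finset.filter_subset_filter _ (Finset.subset_univ U)) (ht.trans (hn _).le)
    simp only [Finset.mem_filter] at this
    rcases this with h | h | h
    · exact hU.five_swap h.1.1 h.2.1 (by decide)
    · exact hU.five_swap h.1.1 h.2.1 (by decide)
    · exact hU.five_swap h.1.1 h.2.1 (by decide)
  have s8 (ht : 4 ≤ n 7) :
      ∃ g : ℝ, (1 - a) * (1 - g) = 4 * b ^ 2 ∧ (g ^ 2 = a ^ 2 ∨ g ^ 2 = b ^ 2) := by
    have := exists_pair_of_card (i := 22) (W := Finset.univ.filter (codeType · = 7)) (by decide)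
      (Finset.filter_subset_filter _ (Finset.subset_univ U)) (ht.trans (hn _).le)
    simp only [Finset.mem_filter] at this
    rcases this with h | h | h
    · exact hU.eight_swap h.1.1 h.2.1 (by decide)
    · exact hU.eight_swap h.1.1 h.2.1 (by decide)
    · exact hU.eight_swap h.1.1 h.2.1 (by decide)
  exact ⟨hle, hE, s5, s8⟩

namespace IsTypeCount

variable {n : Fin 10 → ℕ}

theorem eq_zero (hn : IsTypeCount a b n) (t : Fin 10) (ht : ¬SphereEq a b t) : n t = 0 := by
  by_contra h0
  exact ht (hn.sphereEq t h0)

theorem eq_zero_or (hn : IsTypeCount a b n) (t u : Fin 10)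
    (ht : SphereEq a b t → SphereEq a b u → False) : n t = 0 ∨ n u = 0 := by
  by_contra! h0
  exact ht (hn.sphereEq t h0.1) (hn.sphereEq u h0.2)

theorem eq_zero_or_or (hn : IsTypeCount a b n) (t u v : Fin 10)
    (ht : SphereEq a b t → SphereEq a b u → SphereEq a b v → False) :
    n t = 0 ∨ n u = 0 ∨ n v = 0 := by
  by_contra! h0
  exact ht (hn.sphereEq t h0.1) (hn.sphereEq u h0.2.1) (hn.sphereEq v h0.2.2)

/-- Replacing `b` by `-b` exchanges the conditions with index 2 and 3, exchanges those with index 5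
and 6, and fixes the others. Hence each exclusion needs proof for one sign of `b` only. -/
theorem _root_.SphereEq.neg_3 (e : SphereEq a b 3) : (1 + a) * (1 + -b) = 4 * a ^ 2 := by
  have e : (1 + a) * (1 - b) = 4 * a ^ 2 := e
  linear_combination e

theorem _root_.SphereEq.neg_5 (e : SphereEq a b 5) :
    2 * (-b) ^ 2 + 4 * a ^ 2 * -b + a ^ 3 + 3 * a ^ 2 - a - 1 = 0 := by
  have e : 2 * b ^ 2 - 4 * a ^ 2 * b + a ^ 3 + 3 * a ^ 2 - a - 1 = 0 := e
  linear_combination e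

theorem _root_.SphereEq.neg_6 (e : SphereEq a b 6) :
    2 * (-b) ^ 2 - 4 * a ^ 2 * -b + a ^ 3 + 3 * a ^ 2 - a - 1 = 0 := by
  have e : 2 * b ^ 2 + 4 * a ^ 2 * b + a ^ 3 + 3 * a ^ 2 - a - 1 = 0 := e
  linear_combination e

theorem _root_.SphereEq.neg_4 (e : SphereEq a b 4) : (-b) ^ 2 = 1 - 4 * a ^ 2 := by
  rw [neg_sq]; exact e

theorem _root_.SphereEq.neg_7 (e : SphereEq a b 7) :
    2 * (1 + 2 * a) * (-b) ^ 2 = 1 + a - 3 * a ^ 2 - a ^ 3 := by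
  rw [neg_sq]; exact e

theorem _root_.SphereEq.neg_8 (e : SphereEq a b 8) : 3 * (-b) ^ 2 = 1 + 2 * a := by
  rw [neg_sq]; exact e

theorem _root_.SphereEq.neg_9 (e : SphereEq a b 9) :
    (-b) ^ 2 * (3 + 5 * a) = (1 - a) * (1 + 2 * a) := by
  rw [neg_sq]; exact e

theorem _root_.SphereEq.sq_eq (e : SphereEq a b 1) : a ^ 2 = 1 / 5 := by
  linarith [show 5 * a ^ 2 = 1 from e]

/-- Since `b² = 1 - 4a²`, it suffices to find `a = ±1/3`. The conditions with index 0, 7 and 8 give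
this at once, and those with index 1, 2, 3 and 9 are impossible. -/
theorem angles_of_five (hn : IsTypeCount a b n) (h : IsAnglePair a b)
    (h7 : 7 ≤ n 0 + n 1 + n 2 + n 3 + n 4 + n 5 + n 6 + n 7 + n 8 + n 9)
    (p5 : SphereEq a b 4) : (3 * a = 1 ∨ 3 * a = -1) ∧ 9 * b ^ 2 = 5 := by
  have h' := h.neg_right
  have l0 : n 0 ≤ 1 := hn.le 0
  have l1 : n 1 ≤ 3 := hn.le 1
  have l2 : n 2 ≤ 3 := hn.le 2
  have l3 : n 3 ≤ 3 := hn.le 3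
  have l4 : n 4 ≤ 6 := hn.le 4
  have l5 : n 5 ≤ 3 := hn.le 5
  have l6 : n 6 ≤ 3 := hn.le 6
  have l7 : n 7 ≤ 6 := hn.le 7
  have l8 : n 8 ≤ 1 := hn.le 8
  have l9 : n 9 ≤ 3 := hn.le 9
  have x56 := hn.eq_zero_or 5 6 (not_six_seven h)
  have x89 := hn.eq_zero_or 8 9 (not_nine_ten h)
  have x23 := hn.eq_zero_or 2 3 fun (e : (1 + a) * (1 + b) = _) (e' : (1 + a) * (1 - b) = _) =>
    mul_ne_zero h.one_add_ne_zero h.right_ne_zero (by linear_combination (1 / 2) * (e - e'))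
  have hb : b ^ 2 = 1 - 4 * a ^ 2 := p5
  have of_a (ha : 3 * a = 1 ∨ 3 * a = -1) : (3 * a = 1 ∨ 3 * a = -1) ∧ 9 * b ^ 2 = 5 := by
    refine ⟨ha, ?_⟩
    rcases ha with ha | ha
    · rw [hb, show a = 1 / 3 by linarith]; norm_num
    · rw [hb, show a = -1 / 3 by linarith]; norm_num
  by_cases p1 : SphereEq a b 0
  · exact of_a (Or.inr p1)
  by_cases p8 : SphereEq a b 7
  · exact of_a (Or.inr (good_of_five_eight h p5 p8))
  by_cases p9 : SphereEq a b 8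
  · exact of_a (Or.inl (good_of_five_nine h p5 p9))
  have z1 := hn.eq_zero 1 fun e => h.sq_ne_sq (by rw [hb, SphereEq.sq_eq e]; norm_num)
  have z2 := hn.eq_zero 2 fun e => not_five_three h p5 e
  have z3 := hn.eq_zero 3 fun e => not_five_three h' (SphereEq.neg_4 p5) (SphereEq.neg_3 e)
  have z9 := hn.eq_zero 9 fun e => not_five_ten h p5 e
  have z0 := hn.eq_zero 0 p1
  have z7 := hn.eq_zero 7 p8
  have z8 := hn.eq_zero 8 p9
  -- Only types 4, 5 and 6 remain, and 5 and 6 contribute at most three triples together. So at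
  -- least four are of type 4, and two of these differ by a swap.
  obtain ⟨g, hg, hg2⟩ := hn.five (by omega)
  exact of_a (Or.inl (good_of_five_swap h p5 hg hg2))

/-- The condition with index 7 rules out types 1, 5, 6 and 9. Unless `a = -1/3`, at least four
triples of type 7 are needed, and a swapped pair among them is contradictory as soon as type 8, 2 or
3 helps; type 7 alone has only six. -/
theorem angles_of_eight (hn : IsTypeCount a b n) (h : IsAnglePair a b)
    (h7 : 7 ≤ n 0 + n 1 + n 2 + n 3 + n 4 + n 5 + n 6 + n 7 + n 8 + n 9)
    (z4 : n 4 = 0) (p8 : SphereEq a b 7) : (3 * a = 1 ∨ 3 * a = -1) ∧ 9 * b ^ 2 = 5 := by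
  have h' := h.neg_right
  have l0 : n 0 ≤ 1 := hn.le 0
  have l1 : n 1 ≤ 3 := hn.le 1
  have l2 : n 2 ≤ 3 := hn.le 2
  have l3 : n 3 ≤ 3 := hn.le 3
  have l4 : n 4 ≤ 6 := hn.le 4
  have l5 : n 5 ≤ 3 := hn.le 5
  have l6 : n 6 ≤ 3 := hn.le 6
  have l7 : n 7 ≤ 6 := hn.le 7
  have l8 : n 8 ≤ 1 := hn.le 8
  have l9 : n 9 ≤ 3 := hn.le 9
  have x56 := hn.eq_zero_or 5 6 (not_six_seven h)
  have x89 := hn.eq_zero_or 8 9 (not_nine_ten h)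
  have x23 := hn.eq_zero_or 2 3 fun (e : (1 + a) * (1 + b) = _) (e' : (1 + a) * (1 - b) = _) =>
    mul_ne_zero h.one_add_ne_zero h.right_ne_zero (by linear_combination (1 / 2) * (e - e'))
  have x02 := hn.eq_zero_or 0 2 (not_three_zero h)
  have x03 := hn.eq_zero_or 0 3 fun e e' => not_three_zero h' e (SphereEq.neg_3 e')
  have z1 := hn.eq_zero 1 fun e => not_two_eight h e p8
  have z5 := hn.eq_zero 5 fun e => not_six_eight h e p8
  have z6 := hn.eq_zero 6 fun e => not_six_eight h' (SphereEq.neg_6 e) (SphereEq.neg_7 p8)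
  have z9 := hn.eq_zero 9 fun e => not_eight_ten h p8 e
  by_cases p1 : SphereEq a b 0
  · have e : 2 * (1 + 2 * a) * b ^ 2 = 1 + a - 3 * a ^ 2 - a ^ 3 := p8
    refine ⟨Or.inr p1, ?_⟩
    rw [show a = -1 / 3 by linarith [show 3 * a = -1 from p1]] at e
    linarith
  have z0 := hn.eq_zero 0 p1
  exfalso
  by_cases p9 : SphereEq a b 8
  · have z2 := hn.eq_zero 2 fun e => not_three_eight_nine e p8 p9
    have z3 := hn.eq_zero 3 fun e => not_three_eight_nine (SphereEq.neg_3 e) (SphereEq.neg_7 p8) (SphereEq.neg_8 p9)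
    obtain ⟨g, hg, hg2⟩ := hn.eight (by omega)
    exact not_eight_nine_of_swap p8 p9 hg hg2
  have z8 := hn.eq_zero 8 p9
  obtain ⟨g, hg, hg2⟩ := hn.eight (by omega)
  by_cases p3 : SphereEq a b 2
  · exact not_three_eight_of_swap h p3 p8 hg hg2
  by_cases p4 : SphereEq a b 3
  · exact not_three_eight_of_swap h' (SphereEq.neg_3 p4) (SphereEq.neg_7 p8) (by rwa [neg_sq]) (by rwa [neg_sq])
  have z2 := hn.eq_zero 2 p3
  have z3 := hn.eq_zero 3 p4
  omega

/-- The arithmetic of type statistics without the two types of size six. -/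
theorem lt_seven_of_exclusions {n0 n1 n2 n3 n5 n6 n8 n9 : ℕ}
    (l0 : n0 ≤ 1) (l1 : n1 ≤ 3) (l2 : n2 ≤ 3) (l3 : n3 ≤ 3) (l5 : n5 ≤ 3) (l6 : n6 ≤ 3)
    (l8 : n8 ≤ 1) (l9 : n9 ≤ 3) (x56 : n5 = 0 ∨ n6 = 0) (x89 : n8 = 0 ∨ n9 = 0)
    (x23 : n2 = 0 ∨ n3 = 0) (x02 : n0 = 0 ∨ n2 = 0) (x03 : n0 = 0 ∨ n3 = 0)
    (x01 : n0 = 0 ∨ n1 = 0) (x12 : n1 = 0 ∨ n2 = 0) (x13 : n1 = 0 ∨ n3 = 0)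
    (x19 : n1 = 0 ∨ n9 = 0) (x158 : n1 = 0 ∨ n5 = 0 ∨ n8 = 0) (x168 : n1 = 0 ∨ n6 = 0 ∨ n8 = 0)
    (x059 : n0 = 0 ∨ n5 = 0 ∨ n9 = 0) (x069 : n0 = 0 ∨ n6 = 0 ∨ n9 = 0)
    (x258 : n2 = 0 ∨ n5 = 0 ∨ n8 = 0) (x268 : n2 = 0 ∨ n6 = 0 ∨ n8 = 0)
    (x259 : n2 = 0 ∨ n5 = 0 ∨ n9 = 0) (x269 : n2 = 0 ∨ n6 = 0 ∨ n9 = 0)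
    (x358 : n3 = 0 ∨ n5 = 0 ∨ n8 = 0) (x368 : n3 = 0 ∨ n6 = 0 ∨ n8 = 0)
    (x359 : n3 = 0 ∨ n5 = 0 ∨ n9 = 0) (x369 : n3 = 0 ∨ n6 = 0 ∨ n9 = 0) :
    n0 + n1 + n2 + n3 + n5 + n6 + n8 + n9 < 7 := by
  -- At most one of the types 0 to 3 occurs, so together they give at most three triples, and so do
  -- 5 and 6, and 8 and 9. Having all three groups occur is excluded, except for type 0 with type 8,
  -- which have one triple each.
  obtain ⟨d, hd1, hd2, hd3⟩ : ∃ d, n0 + n1 + n2 + n3 ≤ d ∧ d ≤ 3 ∧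
      (d = 0 ∨ n0 ≠ 0 ∨ n1 ≠ 0 ∨ n2 ≠ 0 ∨ n3 ≠ 0) :=
    ⟨n0 + n1 + n2 + n3, le_rfl, by
      clear * - l0 l1 l2 l3 x23 x02 x03 x01 x12 x13
      omega, by omega⟩
  rcases x56 with h5 | h5 <;> rcases x89 with h8 | h8 <;>
    simp only [h5, h8, or_true, true_or] at * <;> omega

theorem not_of_ne (hn : IsTypeCount a b n) (h : IsAnglePair a b)
    (h7 : 7 ≤ n 0 + n 1 + n 2 + n 3 + n 4 + n 5 + n 6 + n 7 + n 8 + n 9)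
    (z4 : n 4 = 0) (z7 : n 7 = 0) : False := by
  have h' := h.neg_right
  have l0 : n 0 ≤ 1 := hn.le 0
  have l1 : n 1 ≤ 3 := hn.le 1
  have l2 : n 2 ≤ 3 := hn.le 2
  have l3 : n 3 ≤ 3 := hn.le 3
  have l4 : n 4 ≤ 6 := hn.le 4
  have l5 : n 5 ≤ 3 := hn.le 5
  have l6 : n 6 ≤ 3 := hn.le 6
  have l7 : n 7 ≤ 6 := hn.le 7
  have l8 : n 8 ≤ 1 := hn.le 8
  have l9 : n 9 ≤ 3 := hn.le 9
  have x56 := hn.eq_zero_or 5 6 (not_six_seven h)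
  have x89 := hn.eq_zero_or 8 9 (not_nine_ten h)
  have x23 := hn.eq_zero_or 2 3 fun (e : (1 + a) * (1 + b) = _) (e' : (1 + a) * (1 - b) = _) =>
    mul_ne_zero h.one_add_ne_zero h.right_ne_zero (by linear_combination (1 / 2) * (e - e'))
  have x02 := hn.eq_zero_or 0 2 (not_three_zero h)
  have x03 := hn.eq_zero_or 0 3 fun e e' => not_three_zero h' e (SphereEq.neg_3 e')
  have x01 := hn.eq_zero_or 0 1 fun (e : 3 * a = -1) e' => by
    have := SphereEq.sq_eq e'
    rw [show a = -1 / 3 by linarith] at this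
    norm_num at this
  have x12 := hn.eq_zero_or 1 2 fun e e' => ne_of_sq_fifth h (SphereEq.sq_eq e) e'
  have x13 := hn.eq_zero_or 1 3 fun e e' => ne_of_sq_fifth h' (SphereEq.sq_eq e) (SphereEq.neg_3 e')
  have x19 := hn.eq_zero_or 1 9 (not_two_ten h)
  have x158 := hn.eq_zero_or_or 1 5 8 (not_two_six_nine h)
  have x168 := hn.eq_zero_or_or 1 6 8 fun e e' e'' => not_two_six_nine h' e (SphereEq.neg_6 e') (SphereEq.neg_8 e'')
  have x059 := hn.eq_zero_or_or 0 5 9 not_one_six_ten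
  have x069 := hn.eq_zero_or_or 0 6 9 fun e e' e'' => not_one_six_ten e (SphereEq.neg_6 e') (SphereEq.neg_9 e'')
  have x258 := hn.eq_zero_or_or 2 5 8 (not_three_six_nine h)
  have x268 := hn.eq_zero_or_or 2 6 8 not_three_seven_nine
  have x259 := hn.eq_zero_or_or 2 5 9 (not_three_six_ten h)
  have x269 := hn.eq_zero_or_or 2 6 9 not_three_seven_ten
  have x368 := hn.eq_zero_or_or 3 6 8 fun e e' e'' => not_three_six_nine h' (SphereEq.neg_3 e) (SphereEq.neg_6 e') (SphereEq.neg_8 e'')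
  have x358 := hn.eq_zero_or_or 3 5 8 fun e e' e'' => not_three_seven_nine (SphereEq.neg_3 e) (SphereEq.neg_5 e') (SphereEq.neg_8 e'')
  have x369 := hn.eq_zero_or_or 3 6 9 fun e e' e'' => not_three_six_ten h' (SphereEq.neg_3 e) (SphereEq.neg_6 e') (SphereEq.neg_9 e'')
  have x359 := hn.eq_zero_or_or 3 5 9 fun e e' e'' => not_three_seven_ten (SphereEq.neg_3 e) (SphereEq.neg_5 e') (SphereEq.neg_9 e'')
  have := lt_seven_of_exclusions l0 l1 l2 l3 l5 l6 l8 l9 x56 x89 x23 x02 x03 x01 x12 x13 x19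
    x158 x168 x059 x069 x258 x268 x259 x269 x358 x368 x359 x369
  rw [z4, z7] at h7
  omega

end IsTypeCount

/-- The angles of a system of seven triples. -/
theorem angles (hU : IsCodeSystem a b U) (hc : 7 ≤ U.card) :
    (3 * a = 1 ∨ 3 * a = -1) ∧ 9 * b ^ 2 = 5 := by
  have hn := hU.isTypeCount (n := fun t => (U.filter (codeType · = t)).card) fun _ => rfl
  rw [card_eq_sum U (n := fun t => (U.filter (codeType · = t)).card) fun _ => rfl] at hc
  by_cases p5 : SphereEq a b 4
  · exact hn.angles_of_five hU.pair hc p5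
  by_cases p8 : SphereEq a b 7
  · exact hn.angles_of_eight hU.pair hc (hn.eq_zero 4 p5) p8
  · exact (hn.not_of_ne hU.pair hc (hn.eq_zero 4 p5) (hn.eq_zero 7 p8)).elim

/-! ### Admissible triples at the critical angles. -/

/-- Seven lines at angle cosines `1 / 3` and `√5 / 3` that are all encoded by two types. -/
theorem mem_of_third (hU : IsCodeSystem a b U) (ha : 3 * a = 1) (hb : 9 * b ^ 2 = 5) {m : Fin 32}
    (hm : m ∈ U) : codeType m = 4 ∨ codeType m = 8 := by
  have hs := hU.sphereEq hm
  obtain rfl : a = 1 / 3 := by linarith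
  -- At `a = 1/3` and `b² = 5/9`, each unwanted condition is numerically false or gives `b` one of
  -- these rational values.
  have hb1 : b ≠ 2 / 3 := by rintro rfl; norm_num at hb
  have hb2 : b ≠ -2 / 3 := by rintro rfl; norm_num at hb
  have hb5 : b ≠ 1 / 3 := by rintro rfl; norm_num at hb
  have hb6 : b ≠ -1 / 3 := by rintro rfl; norm_num at hb
  generalize codeType m = t at hs ⊢
  fin_cases t <;> simp [SphereEq] at hs ⊢ <;> first
    | (norm_num at hs; done)
    | (exact hb1 (by linarith))
    | (exact hb2 (by linarith))
    | (exact hb5 (by linarith))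
    | (exact hb6 (by linarith))

end IsCodeSystem

namespace IsCodeSystem

variable {a b : ℝ} {U : Finset (Fin 32)}

theorem mem_of_neg_third (hU : IsCodeSystem a b U) (ha : 3 * a = -1) (hb : 9 * b ^ 2 = 5)
    {m : Fin 32} (hm : m ∈ U) : codeType m = 0 ∨ codeType m = 4 ∨ codeType m = 7 := by
  have hs := hU.sphereEq hm
  obtain rfl : a = -1 / 3 := by linarith
  have hb1 : b ≠ 1 / 3 := by rintro rfl; norm_num at hb
  have hb2 : b ≠ -1 / 3 := by rintro rfl; norm_num at hb
  have hb3 : b ≠ 5 / 3 := by rintro rfl; norm_num at hb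
  have hb4 : b ≠ -5 / 3 := by rintro rfl; norm_num at hb
  generalize codeType m = t at hs ⊢
  fin_cases t <;> simp [SphereEq] at hs ⊢ <;> first
    | (norm_num at hs; done)
    | (exact hb1 (by linarith))
    | (exact hb2 (by linarith))
    | (exact hb3 (by linarith))
    | (exact hb4 (by linarith))

/-- The right-hand sides are the squared differences of two distinct entries from `±a, ±b`. With `b²
= 5/9` each of the resulting `g` would force `b` to be rational, or is wrong outright. -/
theorem not_transposition (ha : 3 * a = -1) (hb : 9 * b ^ 2 = 5) {g : ℝ}
    (hg2 : g ^ 2 = a ^ 2 ∨ g ^ 2 = b ^ 2)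
    (hg : (1 - a) * (1 - g) = 4 * a ^ 2 ∨ (1 - a) * (1 - g) = 4 * b ^ 2 ∨
      (1 - a) * (1 - g) = (a + b) ^ 2 ∨ (1 - a) * (1 - g) = (a - b) ^ 2) : False := by
  obtain rfl : a = -1 / 3 := by linarith
  have hb1 : b ≠ 1 / 3 := by rintro rfl; norm_num at hb
  have hb2 : b ≠ -1 / 3 := by rintro rfl; norm_num at hb
  have hb3 : b ≠ 5 / 9 := by rintro rfl; norm_num at hb
  have hb4 : b ≠ -5 / 9 := by rintro rfl; norm_num at hb
  rcases hg with hg | hg | hg | hg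
  · have : g = 2 / 3 := by linarith
    rw [this] at hg2
    rcases hg2 with e | e <;> norm_num at e
    linarith
  · have : g = -2 / 3 := by linarith
    rw [this] at hg2
    rcases hg2 with e | e <;> norm_num at e
    linarith
  · have : g = 1 / 2 + b / 2 := by linarith
    rw [this] at hg2
    rcases hg2 with e | e
    · exact hb4 (by linarith)
    · exact hb1 (by linarith)
  · have : g = 1 / 2 - b / 2 := by linarith
    rw [this] at hg2
    rcases hg2 with e | e
    · exact hb3 (by linarith)
    · exact hb2 (by linarith)

/-- The first set of each pair is a cyclic class of triples and the second holds their odd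
rearrangements. Any two members of opposite classes differ by a transposition, up to no sign change,
so `not_transposition` applies. -/
theorem not_mem_of_odd (hU : IsCodeSystem a b U) (ha : 3 * a = -1) (hb : 9 * b ^ 2 = 5)
    {m m' : Fin 32} (hm : m ∈ U)
    (h : (m ∈ ({10, 11, 12} : Finset (Fin 32)) ∧ m' ∈ ({13, 14, 15} : Finset (Fin 32))) ∨
      (m ∈ ({22, 23, 24} : Finset (Fin 32)) ∧ m' ∈ ({25, 26, 27} : Finset (Fin 32)))) :
    m' ∉ U := by
  intro hm'
  simp only [Finset.mem_insert, Finset.mem_singleton] at h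
  obtain ⟨g, hg, hg2⟩ := hU.exists_inner hm hm' (by rintro rfl; omega) (by
    rcases h with ⟨rfl | rfl | rfl, rfl | rfl | rfl⟩ | ⟨rfl | rfl | rfl, rfl | rfl | rfl⟩ <;>
      simp [codeVec, code, symVal])
  refine not_transposition ha hb hg2 ?_
  rcases h with ⟨rfl | rfl | rfl, rfl | rfl | rfl⟩ | ⟨rfl | rfl | rfl, rfl | rfl | rfl⟩ <;>
    simp [codeVec, code, symVal] at hg <;> first
    | exact Or.inl (by linear_combination (1 / 2) * hg)
    | exact Or.inr (Or.inl (by linear_combination (1 / 2) * hg))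
    | exact Or.inr (Or.inr (Or.inl (by linear_combination (1 / 2) * hg)))
    | exact Or.inr (Or.inr (Or.inr (by linear_combination (1 / 2) * hg)))

theorem subset_or_subset {V A B : Finset (Fin 32)} (hV : V ⊆ A ∪ B)
    (h : ∀ m ∈ V, m ∈ A → ∀ m' ∈ V, m' ∉ B) : V ⊆ A ∨ V ⊆ B := by
  by_cases hA : ∃ m ∈ V, m ∈ A
  · obtain ⟨m, hm, hmA⟩ := hA
    exact Or.inl fun x hx => (Finset.mem_union.1 (hV hx)).resolve_right (h m hm hmA x hx)
  · push Not at hA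
    exact Or.inr fun x hx => (Finset.mem_union.1 (hV hx)).resolve_left (hA x hx)

/-- Only types 0, 4 and 7 are admissible. Types 4 and 7 each contribute triples of a single parity,
hence at most three; reaching seven as `1 + 3 + 3` requires a full parity class of type 4. -/
theorem exists_even_of_neg_third (hU : IsCodeSystem a b U) (hc : 7 ≤ U.card) (ha : 3 * a = -1)
    (hb : 9 * b ^ 2 = 5) : {10, 11, 12} ⊆ U ∨ {13, 14, 15} ⊆ U := by
  by_contra! hcon
  set V := U.filter (codeType · = 4) with hV
  set W := U.filter (codeType · = 7) with hW
  have hVU : V ⊆ U := Finset.filter_subset _ _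
  have hWU : W ⊆ U := Finset.filter_subset _ _
  have hU1 : U ⊆ {0} ∪ V ∪ W := by
    intro m hm
    simp only [Finset.mem_union, hV, hW, Finset.mem_filter, hm, true_and, Finset.mem_singleton]
    have key : ∀ m : Fin 32, codeType m = 0 ∨ codeType m = 4 ∨ codeType m = 7 →
      (m = 0 ∨ codeType m = 4) ∨ codeType m = 7 := by decide
    exact key m (hU.mem_of_neg_third ha hb hm)
  have hcV : V.card < 3 := by
    rcases subset_or_subset (V := V) (A := {10, 11, 12}) (B := {13, 14, 15})
      ((Finset.filter_subset_filter _ (Finset.subset_univ U)).trans (by decide))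
      (fun m hm hmA m' hm' hB => hU.not_mem_of_odd ha hb (hVU hm) (Or.inl ⟨hmA, hB⟩) (hVU hm'))
      with h | h
    · exact Finset.card_lt_card ⟨h, fun h' => hcon.1 (h'.trans hVU)⟩
    · exact Finset.card_lt_card ⟨h, fun h' => hcon.2 (h'.trans hVU)⟩
  have hcW : W.card ≤ 3 := by
    rcases subset_or_subset (V := W) (A := {22, 23, 24}) (B := {25, 26, 27})
      ((Finset.filter_subset_filter _ (Finset.subset_univ U)).trans (by decide))
      (fun m hm hmA m' hm' hB => hU.not_mem_of_odd ha hb (hWU hm) (Or.inr ⟨hmA, hB⟩) (hWU hm'))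
      with h | h
    · exact Finset.card_le_card h
    · exact Finset.card_le_card h
  have h1 := Finset.card_le_card hU1
  have h2 := Finset.card_union_le ({0} ∪ V) W
  have h3 := Finset.card_union_le {0} V
  rw [Finset.card_singleton] at h3
  omega

end IsCodeSystem

/-! ### Vectors seen from an equiangular triangle. -/

-- The Gram matrix is `M Mᵀ` for the square matrix `M` with rows `x i`, so `M` is invertible and
-- annihilates only zero.
open Matrix in
theorem eq_zero_of_inner_eq_zero {x : Fin 3 → EuclideanSpace ℝ (Fin 3)}
    (hx : (Matrix.gram ℝ x).det ≠ 0) {u : EuclideanSpace ℝ (Fin 3)}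
    (hu : ∀ i, inner ℝ (x i) u = 0) : u = 0 := by
  set M : Matrix (Fin 3) (Fin 3) ℝ := Matrix.of fun i j => x i j with hM
  have hG : Matrix.gram ℝ x = M * Mᵀ := by
    ext i j
    simp [Matrix.gram, Matrix.mul_apply, hM, PiLp.inner_apply, mul_comm]
  rw [hG, Matrix.det_mul, Matrix.det_transpose] at hx
  have hdet : M.det ≠ 0 := fun h => hx (by rw [h, zero_mul])
  have := Matrix.eq_zero_of_mulVec_eq_zero hdet (v := fun j => u j) (by
    ext i
    have := hu i
    simpa [Matrix.mulVec, dotProduct, hM, PiLp.inner_apply, mul_comm] using this)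
  ext j
  exact congrFun this j

/-- Three unit vectors with equal mutual inner products. -/
structure IsTriangle (a : ℝ) (x : Fin 3 → EuclideanSpace ℝ (Fin 3)) : Prop where
  norm : ∀ i, ‖x i‖ = 1
  inner : ∀ i j, i ≠ j → inner ℝ (x i) (x j) = a

namespace IsTriangle

variable {a : ℝ} {x : Fin 3 → EuclideanSpace ℝ (Fin 3)}

theorem inner_eq (h : IsTriangle a x) (i j : Fin 3) :
    Inner.inner ℝ (x i) (x j) = if i = j then 1 else a := by
  split_ifs with e
  · subst e
    rw [real_inner_self_eq_norm_sq, h.norm, one_pow]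
  · exact h.inner i j e

theorem det_gram (h : IsTriangle a x) :
    (Matrix.gram ℝ x).det = (1 - a) ^ 2 * (1 + 2 * a) := by
  rw [Matrix.det_fin_three]
  simp only [Matrix.gram_apply, h.inner_eq]
  simp
  ring

theorem eq_zero (h : IsTriangle a x) (ha : (1 - a) * (1 + 2 * a) ≠ 0)
    {u : EuclideanSpace ℝ (Fin 3)} (hu : ∀ i, Inner.inner ℝ (x i) u = 0) : u = 0 := by
  refine eq_zero_of_inner_eq_zero ?_ hu
  rw [h.det_gram]
  have := left_ne_zero_of_mul ha
  have := right_ne_zero_of_mul ha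
  positivity

/-- The Gram matrix is `(1 - a) I + a J`, with `J` the all-ones matrix. Its inverse, multiplied by
`(1 - a)(1 + 2a)`, is `(1 + 2a) I - a J`. -/
theorem expand (h : IsTriangle a x) (ha : (1 - a) * (1 + 2 * a) ≠ 0)
    {v : EuclideanSpace ℝ (Fin 3)} {w : Fin 3 → ℝ} (hw : ∀ i, Inner.inner ℝ (x i) v = w i) :
    ((1 - a) * (1 + 2 * a)) • v =
      ∑ i, ((1 + 2 * a) * w i - a * (w 0 + w 1 + w 2)) • x i := by
  rw [← sub_eq_zero]
  refine h.eq_zero ha fun i => ?_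
  simp only [inner_sub_right, inner_smul_right, Fin.sum_univ_three, inner_add_right, hw,
    h.inner_eq]
  fin_cases i <;> simp <;> ring

theorem inner_formula (h : IsTriangle a x) (ha : (1 - a) * (1 + 2 * a) ≠ 0)
    {v v' : EuclideanSpace ℝ (Fin 3)} {w w' : Fin 3 → ℝ}
    (hw : ∀ i, Inner.inner ℝ (x i) v = w i) (hw' : ∀ i, Inner.inner ℝ (x i) v' = w' i) :
    (1 - a) * (1 + 2 * a) * Inner.inner ℝ v v' =
      (1 + 2 * a) * (w 0 * w' 0 + w 1 * w' 1 + w 2 * w' 2) -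
        a * ((w 0 + w 1 + w 2) * (w' 0 + w' 1 + w' 2)) := by
  have := congrArg (fun u => Inner.inner ℝ u v') (h.expand ha hw)
  simp only [real_inner_smul_left, Fin.sum_univ_three, inner_add_left, hw'] at this
  linear_combination this

theorem ext_inner (h : IsTriangle a x) (ha : (1 - a) * (1 + 2 * a) ≠ 0)
    {v v' : EuclideanSpace ℝ (Fin 3)}
    (hv : ∀ i, Inner.inner ℝ (x i) v = Inner.inner ℝ (x i) v') : v = v' := by
  rw [← sub_eq_zero]
  exact h.eq_zero ha fun i => by rw [inner_sub_right, hv, sub_self]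

end IsTriangle

/-! ### Finding an equiangular triple. -/

/-- Among six points, some three are pairwise related or pairwise unrelated. -/
theorem exists_triple_of_mem {ι : Type*} {c : ι → ι → Prop} (hc : ∀ i j, c i j → c j i) {i : ι}
    {A : Finset ι} (hi : i ∉ A) (hA : ∀ j ∈ A, c i j) (h3 : 3 ≤ A.card) :
    ∃ e : Fin 3 → ι, Function.Injective e ∧
      ((∀ r s, r ≠ s → c (e r) (e s)) ∨ ∀ r s, r ≠ s → ¬c (e r) (e s)) := by
  obtain ⟨j, k, l, hj, hk, hl, hjk, hjl, hkl⟩ := Finset.two_lt_card_iff.1 h3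
  have ne (j) (hj : j ∈ A) : i ≠ j := fun h => hi (h ▸ hj)
  have inj {i j k : ι} (h1 : i ≠ j) (h2 : i ≠ k) (h3 : j ≠ k) :
      Function.Injective ![i, j, k] := by
    intro r s
    fin_cases r <;> fin_cases s <;> simp [h1, h2, h3, h1.symm, h2.symm, h3.symm]
  have pair {c : ι → ι → Prop} (hc : ∀ i j, c i j → c j i) {i j k : ι} (h1 : c i j) (h2 : c i k)
      (h3 : c j k) (r s : Fin 3) (hrs : r ≠ s) : c (![i, j, k] r) (![i, j, k] s) := by
    fin_cases r <;> fin_cases s <;>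
      simp [h1, h2, h3, hc _ _ h1, hc _ _ h2, hc _ _ h3] at hrs ⊢
  by_cases h1 : c j k
  · exact ⟨![i, j, k], inj (ne j hj) (ne k hk) hjk, Or.inl (pair hc (hA j hj) (hA k hk) h1)⟩
  by_cases h2 : c j l
  · exact ⟨![i, j, l], inj (ne j hj) (ne l hl) hjl, Or.inl (pair hc (hA j hj) (hA l hl) h2)⟩
  by_cases h3 : c k l
  · exact ⟨![i, k, l], inj (ne k hk) (ne l hl) hkl, Or.inl (pair hc (hA k hk) (hA l hl) h3)⟩
  exact ⟨![j, k, l], inj hjk hjl hkl,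
    Or.inr (pair (c := fun i j => ¬c i j) (fun i j h h' => h (hc _ _ h')) h1 h2 h3)⟩

/-- Among the five or more points other than `i`, three are all related or all unrelated to `i`. -/
theorem exists_monochromatic_triple {ι : Type*} [Fintype ι] (h6 : 6 ≤ Fintype.card ι)
    {c : ι → ι → Prop} (hc : ∀ i j, c i j → c j i) :
    ∃ e : Fin 3 → ι, Function.Injective e ∧
      ((∀ r s, r ≠ s → c (e r) (e s)) ∨ ∀ r s, r ≠ s → ¬c (e r) (e s)) := by
  classical
  obtain ⟨i⟩ : Nonempty ι := Fintype.card_pos_iff.1 (by omega)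
  set A := (Finset.univ.erase i).filter (c i) with hA
  set B := (Finset.univ.erase i).filter (fun j => ¬c i j) with hB
  have hAB : A.card + B.card = Fintype.card ι - 1 := by
    rw [Finset.card_filter_add_card_filter_not, Finset.card_erase_of_mem (Finset.mem_univ i),
      Finset.card_univ]
  rcases (by omega : 3 ≤ A.card ∨ 3 ≤ B.card) with h | h
  · exact exists_triple_of_mem hc (i := i) (by simp)
      (fun j hj => (Finset.mem_filter.1 hj).2) h
  · obtain ⟨e, he, h1 | h1⟩ := exists_triple_of_mem (c := fun i j => ¬c i j)
      (fun i j h h' => h (hc _ _ h')) (i := i) (by simp)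
      (fun j hj => (Finset.mem_filter.1 hj).2) h
    · exact ⟨e, he, Or.inr h1⟩
    · exact ⟨e, he, Or.inl fun r s hrs => not_not.1 (h1 r s hrs)⟩

/-- Unit vectors whose mutual inner products have modulus `|a|` or `|b|`. -/
structure IsBiangular {ι : Type*} (a b : ℝ) (y : ι → EuclideanSpace ℝ (Fin 3)) : Prop where
  norm : ∀ i, ‖y i‖ = 1
  sq : ∀ i j, i ≠ j → inner ℝ (y i) (y j) ^ 2 = a ^ 2 ∨ inner ℝ (y i) (y j) ^ 2 = b ^ 2

theorem IsBiangular.of_sq {ι : Type*} {a b a' b' : ℝ} {y : ι → EuclideanSpace ℝ (Fin 3)}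
    (h : IsBiangular a b y) (ha : a ^ 2 = a' ^ 2) (hb : b ^ 2 = b' ^ 2) : IsBiangular a' b' y :=
  ⟨h.norm, fun i j hij => by rw [← ha, ← hb]; exact h.sq i j hij⟩

theorem IsBiangular.swap {ι : Type*} {a b : ℝ} {y : ι → EuclideanSpace ℝ (Fin 3)}
    (h : IsBiangular a b y) : IsBiangular b a y :=
  ⟨h.norm, fun i j hij => (h.sq i j hij).symm⟩

/-- Choice of signs making a triple of equiangular lines a triangle. -/
theorem exists_isTriangle {α : ℝ} {y : Fin 3 → EuclideanSpace ℝ (Fin 3)} (hn : ∀ r, ‖y r‖ = 1)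
    (hy : ∀ r s, r ≠ s → inner ℝ (y r) (y s) ^ 2 = α ^ 2) :
    ∃ (a : ℝ) (x : Fin 3 → EuclideanSpace ℝ (Fin 3)), a ^ 2 = α ^ 2 ∧ IsTriangle a x ∧
      ∀ r, x r = y r ∨ x r = -y r := by
  have of3 {a : ℝ} {x : Fin 3 → EuclideanSpace ℝ (Fin 3)} (h1 : inner ℝ (x 0) (x 1) = a)
      (h2 : inner ℝ (x 0) (x 2) = a) (h3 : inner ℝ (x 1) (x 2) = a)
      (hx : ∀ r, x r = y r ∨ x r = -y r) : IsTriangle a x := by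
    refine ⟨fun i => ?_, fun i j hij => ?_⟩
    · rcases hx i with h | h <;> rw [h]
      · exact hn i
      · rw [norm_neg, hn i]
    · fin_cases i <;> fin_cases j <;> simp at hij ⊢ <;>
        first | assumption | (rw [real_inner_comm]; assumption)
  have h01 := sq_eq_sq_iff_eq_or_eq_neg.1 (hy 0 1 (by decide))
  have h02 := sq_eq_sq_iff_eq_or_eq_neg.1 (hy 0 2 (by decide))
  have h12 := sq_eq_sq_iff_eq_or_eq_neg.1 (hy 1 2 (by decide))
  have fin {a : ℝ} {s t : ℝ} (hs : s = 1 ∨ s = -1) (ht : t = 1 ∨ t = -1)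
      (h1 : s * inner ℝ (y 0) (y 1) = a) (h2 : t * inner ℝ (y 0) (y 2) = a)
      (h3 : s * (t * inner ℝ (y 1) (y 2)) = a) (ha : a ^ 2 = α ^ 2) :
      ∃ (a : ℝ) (x : Fin 3 → EuclideanSpace ℝ (Fin 3)), a ^ 2 = α ^ 2 ∧ IsTriangle a x ∧
      ∀ r, x r = y r ∨ x r = -y r := by
    have hx (r : Fin 3) : ![y 0, s • y 1, t • y 2] r = y r ∨
        ![y 0, s • y 1, t • y 2] r = -y r := by
      fin_cases r
      · simp
      · rcases hs with rfl | rfl <;> simp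
      · rcases ht with rfl | rfl <;> simp
    refine ⟨a, ![y 0, s • y 1, t • y 2], ha, of3 ?_ ?_ ?_ hx, hx⟩
    · simpa [inner_smul_right] using h1
    · simpa [inner_smul_right] using h2
    · simpa [inner_smul_right, real_inner_smul_left] using (mul_left_comm t s _).trans h3
  -- Sign changes preserve the product of the three inner products, so an even number of minus signs
  -- leads to `α` and an odd number to `-α`.
  rcases h01 with h01 | h01 <;> rcases h02 with h02 | h02 <;> rcases h12 with h12 | h12
  · exact fin (a := α) (s := 1) (t := 1) (by simp) (by simp) (by simp [h01])
      (by simp [h02]) (by simp [h12]) rfl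
  · exact fin (a := -α) (s := -1) (t := -1) (by simp) (by simp) (by simp [h01])
      (by simp [h02]) (by simp [h12]) (by simp)
  · exact fin (a := -α) (s := -1) (t := 1) (by simp) (by simp) (by simp [h01])
      (by simp [h02]) (by simp [h12]) (by simp)
  · exact fin (a := α) (s := 1) (t := -1) (by simp) (by simp) (by simp [h01])
      (by simp [h02]) (by simp [h12]) rfl
  · exact fin (a := -α) (s := 1) (t := -1) (by simp) (by simp) (by simp [h01])
      (by simp [h02]) (by simp [h12]) (by simp)
  · exact fin (a := α) (s := -1) (t := 1) (by simp) (by simp) (by simp [h01])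
      (by simp [h02]) (by simp [h12]) rfl
  · exact fin (a := α) (s := -1) (t := -1) (by simp) (by simp) (by simp [h01])
      (by simp [h02]) (by simp [h12]) rfl
  · exact fin (a := -α) (s := 1) (t := 1) (by simp) (by simp) (by simp [h01])
      (by simp [h02]) (by simp [h12]) (by simp)

/-! ### From line systems to triples. -/

/-- A system of lines with a distinguished equiangular triple. -/
structure IsTriangulated {ι : Type*} (a b : ℝ) (y : ι → EuclideanSpace ℝ (Fin 3))
    (e : Fin 3 → ι) (x : Fin 3 → EuclideanSpace ℝ (Fin 3)) : Prop where
  biangular : IsBiangular a b y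
  injective : Function.Injective e
  triangle : IsTriangle a x
  sign : ∀ r, x r = y (e r) ∨ x r = -y (e r)

theorem IsBiangular.exists_triangulated {ι : Type*} [Fintype ι] {α β : ℝ}
    {y : ι → EuclideanSpace ℝ (Fin 3)} (hy : IsBiangular α β y) (hc : 6 ≤ Fintype.card ι) :
    ∃ (a b : ℝ) (e : Fin 3 → ι) (x : Fin 3 → EuclideanSpace ℝ (Fin 3)),
      ((a ^ 2 = α ^ 2 ∧ b ^ 2 = β ^ 2) ∨ (a ^ 2 = β ^ 2 ∧ b ^ 2 = α ^ 2)) ∧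
      IsTriangulated a b y e x := by
  obtain ⟨e, he, h | h⟩ := exists_monochromatic_triple hc
    (c := fun i j => inner ℝ (y i) (y j) ^ 2 = α ^ 2) (fun i j h => by rwa [real_inner_comm])
  · obtain ⟨a, x, ha, hx, hs⟩ := exists_isTriangle (y := fun r => y (e r))
      (fun r => hy.norm _) h
    exact ⟨a, β, e, x, Or.inl ⟨ha, rfl⟩, hy.of_sq ha.symm rfl, he, hx, hs⟩
  · obtain ⟨a, x, ha, hx, hs⟩ := exists_isTriangle (y := fun r => y (e r)) (α := β)
      (fun r => hy.norm _) (fun r s hrs => (hy.sq _ _ (he.ne hrs)).resolve_left (h r s hrs))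
    exact ⟨a, α, e, x, Or.inr ⟨ha, rfl⟩, hy.swap.of_sq ha.symm rfl, he, hx, hs⟩

theorem exists_symVal {a b t : ℝ} (h : t ^ 2 = a ^ 2 ∨ t ^ 2 = b ^ 2) : ∃ s, t = symVal a b s := by
  rcases h with h | h <;> rcases sq_eq_sq_iff_eq_or_eq_neg.1 h with h | h
  · exact ⟨0, h⟩
  · exact ⟨2, h⟩
  · exact ⟨1, h⟩
  · exact ⟨3, h⟩

theorem inner_sq_of_sign {E : Type*} [NormedAddCommGroup E] [InnerProductSpace ℝ E]
    {v v' w w' : E} (hv : v = w ∨ v = -w) (hv' : v' = w' ∨ v' = -w') :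
    inner ℝ v v' ^ 2 = inner ℝ w w' ^ 2 := by
  rcases hv with rfl | rfl <;> rcases hv' with rfl | rfl <;> simp

namespace IsTriangulated

variable {ι : Type*} {a b : ℝ} {y : ι → EuclideanSpace ℝ (Fin 3)} {e : Fin 3 → ι}
  {x : Fin 3 → EuclideanSpace ℝ (Fin 3)}

theorem inner_sq (h : IsTriangulated a b y e x) {l : ι} (hl : l ∉ Set.range e) (r : Fin 3) :
    inner ℝ (x r) (y l) ^ 2 = a ^ 2 ∨ inner ℝ (x r) (y l) ^ 2 = b ^ 2 := by
  rw [inner_sq_of_sign (h.sign r) (Or.inl rfl)]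
  exact h.biangular.sq _ _ fun h => hl ⟨r, h⟩

theorem exists_codeVec (h : IsTriangulated a b y e x) {l : ι} (hl : l ∉ Set.range e) :
    ∃ m z, (z = y l ∨ z = -y l) ∧ ∀ r, inner ℝ (x r) z = codeVec a b m r := by
  choose c hc using fun r => exists_symVal (h.inner_sq hl r)
  obtain ⟨m, hm | hm⟩ := exists_code c
  · exact ⟨m, y l, Or.inl rfl, fun r => by rw [codeVec, hm, hc]⟩
  · exact ⟨m, -y l, Or.inr rfl, fun r => by
      rw [codeVec, hm, symVal_add_two, inner_neg_right, hc]⟩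

theorem norm_sign (h : IsTriangulated a b y e x) {l : ι} {z : EuclideanSpace ℝ (Fin 3)}
    (hz : z = y l ∨ z = -y l) : inner ℝ z z = (1 : ℝ) := by
  rw [real_inner_self_eq_norm_sq]
  rcases hz with rfl | rfl <;> simp [h.biangular.norm]

theorem ne_of_ne (h : IsTriangulated a b y e x) (ha : a ^ 2 < 1) (hb : b ^ 2 < 1) {l l' : ι}
    (hll : l ≠ l') {z z' : EuclideanSpace ℝ (Fin 3)} (hz : z = y l ∨ z = -y l)
    (hz' : z' = y l' ∨ z' = -y l') : z ≠ z' := by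
  rintro rfl
  have h1 := inner_sq_of_sign hz hz'
  rw [h.norm_sign hz] at h1
  rcases h.biangular.sq _ _ hll with h2 | h2 <;> linarith

/-- The triples of symbols encoding a system of lines. -/
theorem exists_isCodeSystem [Fintype ι] (h : IsTriangulated a b y e x) (hp : IsAnglePair a b) :
    ∃ (m : ι → Fin 32) (z : ι → EuclideanSpace ℝ (Fin 3)) (U : Finset (Fin 32)),
      (∀ l, z l = y l ∨ z l = -y l) ∧
      (∀ l ∉ Set.range e, ∀ r, inner ℝ (x r) (z l) = codeVec a b (m l) r) ∧
      IsCodeSystem a b U ∧ U.card + 3 = Fintype.card ι ∧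
      ∀ k ∈ U, ∃ l ∉ Set.range e, m l = k := by
  classical
  have hex (l : ι) : ∃ m z, (z = y l ∨ z = -y l) ∧
      (l ∉ Set.range e → ∀ r, inner ℝ (x r) z = codeVec a b m r) := by
    by_cases hl : l ∈ Set.range e
    · exact ⟨0, y l, Or.inl rfl, fun h => (h hl).elim⟩
    · obtain ⟨m, z, hz, hm⟩ := h.exists_codeVec hl
      exact ⟨m, z, hz, fun _ => hm⟩
  choose m z hz hm using hex
  have hd := hp.one_sub_mul_ne_zero
  have ha : a ^ 2 < 1 := by nlinarith [hp.neg_one_lt, hp.lt_one]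
  set S := Finset.univ \ Finset.univ.image e with hS
  have hSm (l : ι) : l ∈ S ↔ l ∉ Set.range e := by simp [hS]
  refine ⟨m, z, S.image m, hz, hm, ⟨hp, ?_, ?_⟩, ?_, ?_⟩
  · intro k hk
    obtain ⟨l, hl, rfl⟩ := Finset.mem_image.1 hk
    have := h.triangle.inner_formula hd (hm l ((hSm l).1 hl)) (hm l ((hSm l).1 hl))
    rw [h.norm_sign (hz l), mul_one] at this
    exact this.symm
  · intro k hk k' hk' hkk
    obtain ⟨l, hl, rfl⟩ := Finset.mem_image.1 hk
    obtain ⟨l', hl', rfl⟩ := Finset.mem_image.1 hk'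
    refine ⟨inner ℝ (z l) (z l'),
      h.triangle.inner_formula hd (hm l ((hSm l).1 hl)) (hm l' ((hSm l').1 hl')), ?_⟩
    rw [inner_sq_of_sign (hz l) (hz l')]
    exact h.biangular.sq _ _ fun h => hkk (by rw [h])
  -- Equal codes mean equal inner products with a basis, hence equal vectors, which distinct lines
  -- cannot share.
  · have hinj : Set.InjOn m S := by
      intro l hl l' hl' hll
      by_contra hne
      refine h.ne_of_ne ha hp.sq_lt_one hne (hz l) (hz l') (h.triangle.ext_inner hd fun r => ?_)
      rw [hm l ((hSm l).1 hl), hm l' ((hSm l').1 hl'), hll]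
    rw [Finset.card_image_of_injOn hinj, hS, Finset.card_univ_sdiff,
      Finset.card_image_of_injective _ h.injective, Finset.card_univ, Fintype.card_fin]
    have := Fintype.card_le_of_injective e h.injective
    rw [Fintype.card_fin] at this
    omega
  · intro k hk
    obtain ⟨l, hl, rfl⟩ := Finset.mem_image.1 hk
    exact ⟨l, (hSm l).1 hl, rfl⟩

/-- A system of ten lines contains three lines with mutual inner products `1 / 3`. -/
theorem exists_third [Fintype ι] (h : IsTriangulated a b y e x) (hp : IsAnglePair a b)
    (hc : 10 ≤ Fintype.card ι) :
    ∃ (e' : Fin 3 → ι) (x' : Fin 3 → EuclideanSpace ℝ (Fin 3)),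
      IsTriangulated (1 / 3) (√5 / 3) y e' x' := by
  obtain ⟨m, z, U, hz, hm, hU, hcU, hUl⟩ := h.exists_isCodeSystem hp
  obtain ⟨ha, hb⟩ := hU.angles (by omega)
  have hb' : b ^ 2 = (√5 / 3) ^ 2 := by
    rw [div_pow, Real.sq_sqrt (by norm_num)]; linarith
  have hy : IsBiangular (1 / 3) (√5 / 3) y := by
    refine h.biangular.of_sq ?_ hb'
    rcases ha with ha | ha
    · rw [show a = 1 / 3 by linarith]
    · rw [show a = -1 / 3 by linarith]; norm_num
  rcases ha with ha | ha
  · obtain rfl : a = 1 / 3 := by linarith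
    exact ⟨e, x, hy, h.injective, h.triangle, h.sign⟩
  have hd := hp.one_sub_mul_ne_zero
  have hval : (1 - a) * (1 + 2 * a) = 4 / 9 := by
    rw [show a = -1 / 3 by linarith]; norm_num
  -- The value `4/27`, divided by `(1 - a)(1 + 2a) = 4/9`, is the desired inner product `1/3`.
  have fin (k : Fin 3 → Fin 32) (hk : Function.Injective k) (hkU : ∀ r, k r ∈ U)
      (hkv : ∀ r s, r ≠ s → triForm a (codeVec a b (k r)) (codeVec a b (k s)) = 4 / 27) :
      ∃ (e' : Fin 3 → ι) (x' : Fin 3 → EuclideanSpace ℝ (Fin 3)),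
        IsTriangulated (1 / 3) (√5 / 3) y e' x' := by
    choose l hl hml using fun r => hUl (k r) (hkU r)
    refine ⟨l, fun r => z (l r), hy, fun r s hrs => hk ?_, ⟨fun r => ?_, fun r s hrs => ?_⟩,
      fun r => hz _⟩
    · rw [← hml r, ← hml s, hrs]
    · rcases hz (l r) with h1 | h1 <;> rw [h1]
      · exact h.biangular.norm _
      · rw [norm_neg, h.biangular.norm]
    · have := h.triangle.inner_formula hd (hm _ (hl r)) (hm _ (hl s))
      rw [hml, hml] at this
      have h2 := (this.trans (hkv r s hrs))
      rw [hval] at h2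
      linarith
  obtain rfl : a = -1 / 3 := by linarith
  rcases hU.exists_even_of_neg_third (by omega) ha hb with hs | hs
  · refine fin ![10, 11, 12] (by decide) (fun r => hs (by revert r; decide)) fun r s hrs => ?_
    fin_cases r <;> fin_cases s <;> simp [triForm, codeVec, code, symVal] at hrs ⊢ <;>
      linarith
  · refine fin ![13, 14, 15] (by decide) (fun r => hs (by revert r; decide)) fun r s hrs => ?_
    fin_cases r <;> fin_cases s <;> simp [triForm, codeVec, code, symVal] at hrs ⊢ <;>
      linarith

end IsTriangulated

namespace IsTriangulated

variable {ι : Type*} {a b : ℝ} {y : ι → EuclideanSpace ℝ (Fin 3)} {e : Fin 3 → ι}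
  {x : Fin 3 → EuclideanSpace ℝ (Fin 3)}

/-- Encoding of a system of lines by integer vectors, for rationally dependent symbols. -/
theorem exists_intCode (h : IsTriangulated a b y e x) {κ : ℝ} {T : Fin 4 → ℤ}
    (hT : ∀ s, symVal a b s = κ * T s) {n : ℕ} [NeZero n] {W : Fin n → Fin 3 → ℤ}
    (hW : ∀ l ∉ Set.range e, ∀ c : Fin 3 → Fin 4, (∀ r, inner ℝ (x r) (y l) = κ * T (c r)) →
      ∃ k, (∀ r, W k r = T (c r)) ∨ ∀ r, W k r = -T (c r)) :
    ∃ (m : ι → Fin n) (z : ι → EuclideanSpace ℝ (Fin 3)), (∀ l, z l = y l ∨ z l = -y l) ∧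
      ∀ l ∉ Set.range e, ∀ r, inner ℝ (x r) (z l) = κ * W (m l) r := by
  have hex (l : ι) : ∃ (m : Fin n) (z : EuclideanSpace ℝ (Fin 3)), (z = y l ∨ z = -y l) ∧
      (l ∉ Set.range e → ∀ r, inner ℝ (x r) z = κ * W m r) := by
    by_cases hl : l ∈ Set.range e
    · exact ⟨0, y l, Or.inl rfl, fun h => (h hl).elim⟩
    choose c hc using fun r => exists_symVal (h.inner_sq hl r)
    obtain ⟨k, hk | hk⟩ := hW l hl c fun r => by rw [hc, hT]
    · exact ⟨k, y l, Or.inl rfl, fun _ r => by rw [hk, hc, hT]⟩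
    · exact ⟨k, -y l, Or.inr rfl, fun _ r => by
        rw [hk, inner_neg_right, hc, hT]; push_cast; ring⟩
  choose m z hz hm using hex
  exact ⟨m, z, hz, hm⟩

open Classical in
theorem card_compl_range [Fintype ι] (h : IsTriangulated a b y e x) :
    (Finset.univ.filter (· ∉ Set.range e)).card + 3 = Fintype.card ι := by
  have h1 : (Finset.univ.filter (· ∈ Set.range e)).card = 3 := by
    rw [show Finset.univ.filter (· ∈ Set.range e) = Finset.univ.image e by ext; simp,
      Finset.card_image_of_injective _ h.injective, Finset.card_univ, Fintype.card_fin]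
  have h2 := Finset.card_filter_add_card_filter_not (s := Finset.univ) (· ∈ Set.range e)
  rw [h1, Finset.card_univ] at h2
  omega

end IsTriangulated

/-! ### Systems with a right angle. -/

/-- The nonzero vectors with entries `0, ±1` up to sign, preceded by the zero vector. -/
def ternary : Fin 14 → Fin 3 → ℤ := ![
  ![0, 0, 0],
  ![1, 0, 0], ![0, 1, 0], ![0, 0, 1],
  ![0, 1, 1], ![1, 0, 1], ![1, 1, 0],
  ![0, 1, -1], ![1, 0, -1], ![1, -1, 0],
  ![1, 1, 1],
  ![-1, 1, 1], ![1, -1, 1], ![1, 1, -1]]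

set_option maxRecDepth 100000 in
theorem exists_ternary (c : Fin 3 → Fin 4) :
    (∃ k, (∀ r, ternary k r = ![1, 0, -1, 0] (c r)) ∨
      ∀ r, ternary k r = -![1, 0, -1, 0] (c r)) ∧
    ∃ k, (∀ r, ternary k r = ![0, 1, 0, -1] (c r)) ∨
      ∀ r, ternary k r = -![0, 1, 0, -1] (c r) := by
  revert c; decide

/-- The orbits of ternary vectors under signs and permutations of coordinates. -/
def ternaryType : Fin 14 → Fin 6 := ![0, 1, 1, 1, 2, 2, 2, 3, 3, 3, 4, 5, 5, 5]

/-- The tables list the sum of squares and the square of the sum of the coordinates for each type.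
Type 1 is set aside because it may coexist with another type. -/
theorem ternary_angle {a : ℝ} {t : Fin 6} (h1a : 1 - a ≠ 0) (h1b : 1 + a ≠ 0)
    (hd : 1 + 2 * a ≠ 0) (h : a ^ 2 * ((1 + 2 * a) * ![0, 1, 2, 2, 3, 3] t -
      a * ![0, 1, 4, 0, 9, 1] t) = (1 - a) * (1 + 2 * a)) (ht : t ≠ 1) :
    (t = 2 ∧ 4 * a ^ 2 = 1 + a) ∨ (t = 3 ∧ a = 1 / 2) ∨ (t = 4 ∧ a = -1 / 3) ∨
      (t = 5 ∧ 5 * a ^ 2 = 1) := by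
  fin_cases t <;> simp at h ht ⊢
  · exact (h.elim h1a hd).elim
  · linarith
  · have e : (1 + a) * (1 + 2 * a) * (2 * a - 1) = 0 := by linear_combination h
    linarith [(mul_eq_zero.1 e).resolve_left (mul_ne_zero h1b hd)]
  · have e : (1 - a) ^ 2 * (3 * a + 1) = 0 := by linear_combination -h
    linarith [(mul_eq_zero.1 e).resolve_left (pow_ne_zero 2 h1a)]
  · have e : (1 + a) * (5 * a ^ 2 - 1) = 0 := by linear_combination h
    linarith [(mul_eq_zero.1 e).resolve_left h1b]

namespace IsTriangulated

variable {ι : Type*} {a b : ℝ} {y : ι → EuclideanSpace ℝ (Fin 3)} {e : Fin 3 → ι}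
  {x : Fin 3 → EuclideanSpace ℝ (Fin 3)}

/-- The ternary vectors encoding a system of lines, one of whose angles is right. -/
theorem exists_ternary_system [Fintype ι] (h : IsTriangulated a b y e x) {κ : ℝ} {T : Fin 4 → ℤ}
    (hT : ∀ s, symVal a b s = κ * T s) (hd : (1 - a) * (1 + 2 * a) ≠ 0)
    (ha : a ^ 2 < 1) (hb : b ^ 2 < 1)
    (hW : ∀ c : Fin 3 → Fin 4, ∃ k, (∀ r, ternary k r = T (c r)) ∨ ∀ r, ternary k r = -T (c r)) :
    ∃ U : Finset (Fin 14), U.card + 3 = Fintype.card ι ∧ ∀ k ∈ U,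
      κ ^ 2 * ((1 + 2 * a) * ![0, 1, 2, 2, 3, 3] (ternaryType k) -
        a * ![0, 1, 4, 0, 9, 1] (ternaryType k)) = (1 - a) * (1 + 2 * a) := by
  classical
  obtain ⟨m, z, hz, hm⟩ := h.exists_intCode hT (W := ternary) (fun l _ c _ => hW c)
  refine ⟨(Finset.univ.filter (· ∉ Set.range e)).image m, ?_, fun k hk => ?_⟩
  · rw [← h.card_compl_range, Finset.card_image_of_injOn]
    intro l hl l' hl' hll
    by_contra hne
    refine h.ne_of_ne ha hb hne (hz l) (hz l') (h.triangle.ext_inner hd fun r => ?_)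
    rw [hm l (Finset.mem_filter.1 hl).2, hm l' (Finset.mem_filter.1 hl').2, hll]
  · obtain ⟨l, hl, rfl⟩ := Finset.mem_image.1 hk
    have hl := (Finset.mem_filter.1 hl).2
    have := h.triangle.inner_formula hd (hm l hl) (hm l hl)
    rw [h.norm_sign (hz l), mul_one] at this
    rw [this]
    generalize m l = k
    fin_cases k <;> simp [ternary, ternaryType] <;> ring

/-- For `a = 0` unit length says that `b²` times the squared norm of the ternary vector is `1`. All
codes therefore have the same squared norm, and at most six share one. -/
theorem card_le_of_left_eq_zero [Fintype ι] (h : IsTriangulated 0 b y e x) (hb : b ^ 2 < 1) :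
    Fintype.card ι ≤ 9 := by
  obtain ⟨U, hU, hE⟩ := h.exists_ternary_system (κ := b) (T := ![0, 1, 0, -1])
    (fun s => by fin_cases s <;> simp [symVal]) (by norm_num) (by norm_num) hb
    (fun c => (exists_ternary c).2)
  by_contra! hc
  obtain ⟨k, hk⟩ : U.Nonempty := Finset.card_pos.1 (by omega)
  have hsub : U ⊆ Finset.univ.filter fun k' =>
      (![0, 1, 2, 2, 3, 3] (ternaryType k') : ℕ) = ![0, 1, 2, 2, 3, 3] (ternaryType k) := by
    intro k' hk'
    have h1 := hE k hk
    have h2 := hE k' hk'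
    simp only [Finset.mem_filter, Finset.mem_univ, true_and]
    generalize b ^ 2 = B at *
    generalize ternaryType k = t at *
    generalize ternaryType k' = t' at *
    fin_cases t <;> fin_cases t' <;> simp at h1 h2 ⊢ <;> linarith
  have h1 := Finset.card_le_card hsub
  have key : ∀ k : Fin 14, (Finset.univ.filter fun k' =>
      (![0, 1, 2, 2, 3, 3] (ternaryType k') : ℕ) =
        ![0, 1, 2, 2, 3, 3] (ternaryType k)).card ≤ 6 := by decide
  have := key k
  omega

/-- The four alternatives of `ternary_angle` exclude each other, so besides type 1 only one type
occurs. Two types have at most six vectors. -/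
theorem card_le_of_right_eq_zero [Fintype ι] (h : IsTriangulated a 0 y e x) (h1 : -1 < a)
    (h2 : a < 1) (h0 : a ≠ 0) (hd : 1 + 2 * a ≠ 0) : Fintype.card ι ≤ 9 := by
  have h1a : 1 - a ≠ 0 := by intro h; linarith
  have h1b : 1 + a ≠ 0 := by intro h; linarith
  obtain ⟨U, hU, hE⟩ := h.exists_ternary_system (κ := a) (T := ![1, 0, -1, 0])
    (fun s => by fin_cases s <;> simp [symVal]) (mul_ne_zero h1a hd) (by nlinarith) (by norm_num)
    (fun c => (exists_ternary c).1)
  by_contra! hc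
  have hE' (k) (hk : k ∈ U) := ternary_angle h1a h1b hd (hE k hk)
  obtain ⟨t, ht⟩ : ∃ t, ∀ k ∈ U, ternaryType k = 1 ∨ ternaryType k = t := by
    by_cases hex : ∃ k ∈ U, ternaryType k ≠ 1
    · obtain ⟨k, hk, hk1⟩ := hex
      refine ⟨ternaryType k, fun k' hk' => or_iff_not_imp_left.2 fun hk1' => ?_⟩
      have c1 : a = 1 / 2 → 4 * a ^ 2 ≠ 1 + a := by rintro rfl; norm_num
      have c2 : a = 1 / 2 → 5 * a ^ 2 ≠ 1 := by rintro rfl; norm_num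
      have c3 : a = -1 / 3 → 4 * a ^ 2 ≠ 1 + a := by rintro rfl; norm_num
      have c4 : a = -1 / 3 → 5 * a ^ 2 ≠ 1 := by rintro rfl; norm_num
      have c5 : a = -1 / 3 → a ≠ 1 / 2 := by rintro rfl; norm_num
      have c6 : 4 * a ^ 2 = 1 + a → 5 * a ^ 2 ≠ 1 := by
        intro h h'
        rw [show a = -1 / 5 by linarith] at h'
        norm_num at h'
      rcases hE' k hk hk1 with e | e | e | e <;> rcases hE' k' hk' hk1' with e' | e' | e' | e' <;>
        first
          | exact e'.1.trans e.1.symm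
          | exact absurd e'.2 (c1 e.2)
          | exact absurd e'.2 (c2 e.2)
          | exact absurd e'.2 (c3 e.2)
          | exact absurd e'.2 (c4 e.2)
          | exact absurd e'.2 (c5 e.2)
          | exact absurd e'.2 (c6 e.2)
          | exact absurd e.2 (c1 e'.2)
          | exact absurd e.2 (c2 e'.2)
          | exact absurd e.2 (c3 e'.2)
          | exact absurd e.2 (c4 e'.2)
          | exact absurd e.2 (c5 e'.2)
          | exact absurd e.2 (c6 e'.2)
    · push Not at hex
      exact ⟨1, fun k hk => Or.inl (hex k hk)⟩
  have h1 := Finset.card_le_card (show U ⊆ Finset.univ.filter fun k =>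
    ternaryType k = 1 ∨ ternaryType k = t from fun k hk => by simpa using ht k hk)
  have key : ∀ t : Fin 6, (Finset.univ.filter fun k =>
    ternaryType k = 1 ∨ ternaryType k = t).card ≤ 6 := by decide
  have := key t
  omega

end IsTriangulated

/-! ### Systems whose triangle is coplanar. -/

namespace IsTriangle

variable {x : Fin 3 → EuclideanSpace ℝ (Fin 3)}

theorem sum_eq_zero (h : IsTriangle (-1 / 2) x) : x 0 + x 1 + x 2 = 0 := by
  rw [← inner_self_eq_zero (𝕜 := ℝ)]
  simp only [inner_add_left, inner_add_right, h.inner_eq]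
  simp
  norm_num

theorem inner_sum_eq_zero (h : IsTriangle (-1 / 2) x) {z : EuclideanSpace ℝ (Fin 3)}
    {w : Fin 3 → ℝ} (hw : ∀ r, Inner.inner ℝ (x r) z = w r) : w 0 + w 1 + w 2 = 0 := by
  rw [← hw, ← hw, ← hw, ← inner_add_left, ← inner_add_left, h.sum_eq_zero, inner_zero_left]

/-- Two unit vectors with the same projection to a plane are mirror images of each other. -/
theorem add_eq (h : IsTriangle (-1 / 2) x) {z z' : EuclideanSpace ℝ (Fin 3)} {w : Fin 3 → ℝ}
    (hz : Inner.inner ℝ z z = (1 : ℝ)) (hz' : Inner.inner ℝ z' z' = (1 : ℝ))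
    (hw : ∀ r, Inner.inner ℝ (x r) z = w r) (hw' : ∀ r, Inner.inner ℝ (x r) z' = w r)
    (hne : z ≠ z') :
    z + z' = (4 / 3 : ℝ) • (w 0 • x 0 + w 1 • x 1 + w 2 • x 2) := by
  have hs := h.inner_sum_eq_zero hw
  have hd (r : Fin 3) : Inner.inner ℝ (x r) (z - z') = (0 : ℝ) := by
    rw [inner_sub_right, hw, hw', sub_self]
  have hd' (r : Fin 3) : Inner.inner ℝ (z - z') (x r) = (0 : ℝ) := by
    rw [real_inner_comm, hd]
  have hzz : Inner.inner ℝ (z - z') (z - z') ≠ (0 : ℝ) := by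
    rw [Ne, inner_self_eq_zero, sub_eq_zero]; exact hne
  rw [← sub_eq_zero]
  -- The difference `z - z'` is normal to the plane of the triangle, so it completes `x 0`, `x 1` to
  -- a basis. Against this basis both sides agree, the right-hand side being twice the projection of
  -- `z` to the plane.
  refine eq_zero_of_inner_eq_zero (x := ![x 0, x 1, z - z']) ?_ fun i => ?_
  · rw [Matrix.det_fin_three]
    simp only [Matrix.gram_apply, Matrix.cons_val_zero, Matrix.cons_val_one, Matrix.cons_val,
      h.inner_eq, hd, hd']
    generalize Inner.inner ℝ (z - z') (z - z') = D at hzz ⊢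
    norm_num
    intro h0
    exact hzz (by linarith)
  · have h3 : Inner.inner ℝ (z - z') (z + z') = (0 : ℝ) := by
      simp only [inner_add_right, inner_sub_left, hz, hz', real_inner_comm z z']
      ring
    fin_cases i
    · simp [inner_sub_right, inner_add_right, inner_smul_right, h.inner_eq, hw, hw', h.norm]
      linarith
    · simp [inner_sub_right, inner_add_right, inner_smul_right, h.inner_eq, hw, hw', h.norm]
      linarith
    · change Inner.inner ℝ (z - z') (z + z' - _) = _
      rw [inner_sub_right, h3]
      simp [inner_add_right, inner_smul_right, hd']

theorem inner_of_ne (h : IsTriangle (-1 / 2) x) {z z' : EuclideanSpace ℝ (Fin 3)} {w : Fin 3 → ℝ}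
    (hz : Inner.inner ℝ z z = (1 : ℝ)) (hz' : Inner.inner ℝ z' z' = (1 : ℝ))
    (hw : ∀ r, Inner.inner ℝ (x r) z = w r) (hw' : ∀ r, Inner.inner ℝ (x r) z' = w r)
    (hne : z ≠ z') :
    Inner.inner ℝ z z' = 4 / 3 * (w 0 ^ 2 + w 1 ^ 2 + w 2 ^ 2) - 1 := by
  have := congrArg (fun u => Inner.inner ℝ u z) (h.add_eq hz hz' hw hw' hne)
  simp only [inner_add_left, real_inner_smul_left, hw, hz, real_inner_comm z z'] at this
  linarith

end IsTriangle

namespace IsTriangulated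

variable {ι : Type*} {a b : ℝ} {y : ι → EuclideanSpace ℝ (Fin 3)} {e : Fin 3 → ι}
  {x : Fin 3 → EuclideanSpace ℝ (Fin 3)}

theorem int_sum_eq_zero (h : IsTriangulated (-1 / 2) b y e x) {κ : ℝ} (hκ : κ ≠ 0)
    {w : Fin 3 → ℤ} {z : EuclideanSpace ℝ (Fin 3)} (hw : ∀ r, inner ℝ (x r) z = κ * w r) :
    w 0 + w 1 + w 2 = 0 := by
  have := h.triangle.inner_sum_eq_zero hw
  rw [← mul_add, ← mul_add] at this
  exact_mod_cast (mul_eq_zero.1 this).resolve_left hκ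

/-- Zero-sum triples from `{0, ±1/2}` fall into four classes up to sign. Mirror images over one
class would have inner product `-1` or `-1/3`, which is not allowed, so each class carries at most
one line. -/
theorem card_le_of_flat_of_zero [Fintype ι] (h : IsTriangulated (-1 / 2) 0 y e x) :
    Fintype.card ι ≤ 9 := by
  classical
  obtain ⟨m, z, hz, hm⟩ := h.exists_intCode (κ := 1 / 2) (T := ![-1, 0, 1, 0])
    (W := ![![0, 0, 0], ![0, 1, -1], ![1, 0, -1], ![1, -1, 0]])
    (fun s => by fin_cases s <;> norm_num [symVal]) (fun l hl c hc => by
      have := h.int_sum_eq_zero (w := fun r => ![-1, 0, 1, 0] (c r)) (by norm_num) hc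
      clear hc
      revert c; decide)
  have hinj : Set.InjOn m (Finset.univ.filter (· ∉ Set.range e)) := by
    intro l hl l' hl' hll
    by_contra hne
    have h1 := hm l (Finset.mem_filter.1 hl).2
    have h2 := hm l' (Finset.mem_filter.1 hl').2
    rw [← hll] at h2
    have h3 := h.triangle.inner_of_ne (h.norm_sign (hz l)) (h.norm_sign (hz l')) h1 h2
      (h.ne_of_ne (by norm_num) (by norm_num) hne (hz l) (hz l'))
    have h4 := h.biangular.sq l l' hne
    rw [← inner_sq_of_sign (hz l) (hz l'), h3] at h4
    generalize m l = k at h4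
    fin_cases k <;> simp at h4 <;> norm_num at h4
  have h1 := Finset.card_image_of_injOn hinj
  have h2 := Finset.card_le_univ ((Finset.univ.filter (· ∉ Set.range e)).image m)
  rw [Fintype.card_fin] at h2
  have := h.card_compl_range
  omega

/-- There are three zero-sum triples up to sign, and each carries at most two lines, since a vector
has only one mirror image. -/
theorem card_le_of_flat_of_fourth [Fintype ι] (h : IsTriangulated (-1 / 2) (1 / 4) y e x) :
    Fintype.card ι ≤ 9 := by
  classical
  obtain ⟨m, z, hz, hm⟩ := h.exists_intCode (κ := 1 / 4) (T := ![-2, 1, 2, -1])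
    (W := ![![-2, 1, 1], ![1, -2, 1], ![1, 1, -2]])
    (fun s => by fin_cases s <;> norm_num [symVal]) (fun l hl c hc => by
      have := h.int_sum_eq_zero (w := fun r => ![-2, 1, 2, -1] (c r)) (by norm_num) hc
      clear hc
      revert c; decide)
  by_contra! hc
  have := h.card_compl_range
  obtain ⟨k, -, hk⟩ := Finset.exists_lt_card_fiber_of_mul_lt_card_of_maps_to (n := 2)
    (s := Finset.univ.filter (· ∉ Set.range e)) (t := Finset.univ) (f := m) (by simp)
    (by rw [Finset.card_univ, Fintype.card_fin]; omega)
  obtain ⟨l1, l2, l3, h1, h2, h3, h12, h13, h23⟩ := Finset.two_lt_card_iff.1 hk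
  simp only [Finset.mem_filter, Finset.mem_univ, true_and] at h1 h2 h3
  have w1 := hm l1 h1.1
  have w2 := hm l2 h2.1
  have w3 := hm l3 h3.1
  rw [h1.2] at w1
  rw [h2.2] at w2
  rw [h3.2] at w3
  have ne {l l' : ι} (hne : l ≠ l') : z l ≠ z l' :=
    h.ne_of_ne (by norm_num) (by norm_num) hne (hz l) (hz l')
  have nz (l : ι) := h.norm_sign (hz l)
  have e12 := h.triangle.add_eq (nz l1) (nz l2) w1 w2 (ne h12)
  have e13 := h.triangle.add_eq (nz l1) (nz l3) w1 w3 (ne h13)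
  exact ne h23 (add_left_cancel (e12.trans e13.symm))

/-- Three numbers from `{±1/2, ±b}` add up to zero only if `b` is `0`, `±1/4` or `±1`. Otherwise the
triangle is the whole system. -/
theorem card_le_of_flat [Fintype ι] (h : IsTriangulated (-1 / 2) b y e x) (hb : b ^ 2 < 1)
    (hb4 : b ^ 2 ≠ 1 / 4) : Fintype.card ι ≤ 9 := by
  by_cases hb0 : b = 0
  · subst hb0
    exact h.card_le_of_flat_of_zero
  by_cases hb1 : b ^ 2 = (1 / 4) ^ 2
  · exact IsTriangulated.card_le_of_flat_of_fourth
      ⟨h.biangular.of_sq rfl hb1, h.injective, h.triangle, h.sign⟩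
  have n1 : b ≠ 1 / 4 := by rintro rfl; exact hb1 rfl
  have n2 : b ≠ -1 / 4 := by rintro rfl; exact hb1 (by norm_num)
  have n3 : b ≠ 1 := by rintro rfl; norm_num at hb
  have n4 : b ≠ -1 := by rintro rfl; norm_num at hb
  have n5 : b ≠ 1 / 2 := by rintro rfl; norm_num at hb4
  have n6 : b ≠ -1 / 2 := by rintro rfl; norm_num at hb4
  classical
  have : Finset.univ.filter (· ∉ Set.range e) = ∅ := by
    rw [Finset.filter_eq_empty_iff]
    intro l _ hl
    choose c hc using fun r => exists_symVal (h.inner_sq hl r)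
    have hs := h.triangle.inner_sum_eq_zero hc
    generalize c 0 = c0 at hs
    generalize c 1 = c1 at hs
    generalize c 2 = c2 at hs
    fin_cases c0 <;> fin_cases c1 <;> fin_cases c2 <;> simp [symVal] at hs <;> first
      | (exact hb0 (by linarith))
      | (exact n1 (by linarith))
      | (exact n2 (by linarith))
      | (exact n3 (by linarith))
      | (exact n4 (by linarith))
  have h1 := h.card_compl_range
  rw [this, Finset.card_empty] at h1
  omega

end IsTriangulated

/-! ### Determination of the Gram matrix and uniqueness up to isometry. -/

theorem isAnglePair_third : IsAnglePair (1 / 3) (√5 / 3) := by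
  have h5 : √5 ^ 2 = 5 := Real.sq_sqrt (by norm_num)
  refine ⟨by norm_num, by norm_num, ?_, by norm_num, by positivity, by norm_num, ?_⟩ <;>
    rw [div_pow (√5), h5] <;> norm_num

theorem IsBiangular.exists_third {ι : Type*} [Fintype ι] {α β : ℝ}
    {y : ι → EuclideanSpace ℝ (Fin 3)} (hy : IsBiangular α β y) (hα : α ^ 2 < 1) (hβ : β ^ 2 < 1)
    (hαβ : α ^ 2 ≠ β ^ 2) (hc : 10 ≤ Fintype.card ι) :
    ∃ (e : Fin 3 → ι) (x : Fin 3 → EuclideanSpace ℝ (Fin 3)),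
      IsTriangulated (1 / 3) (√5 / 3) y e x := by
  obtain ⟨a, b, e, x, hab, h⟩ := hy.exists_triangulated (by omega)
  have ha : a ^ 2 < 1 := by rcases hab with h | h <;> rw [h.1] <;> assumption
  have hb : b ^ 2 < 1 := by rcases hab with h | h <;> rw [h.2] <;> assumption
  have hne : a ^ 2 ≠ b ^ 2 := by
    rcases hab with h | h <;> rw [h.1, h.2]
    · exact hαβ
    · exact hαβ.symm
  obtain ⟨h1, h2⟩ := abs_lt.1 ((sq_lt_one_iff_abs_lt_one a).1 ha)
  have hnc : ¬Fintype.card ι ≤ 9 := by omega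
  by_cases hd : 1 + 2 * a = 0
  · obtain rfl : a = -1 / 2 := by linarith
    exact (hnc (h.card_le_of_flat hb fun h4 => hne (by rw [h4]; norm_num))).elim
  by_cases ha0 : a = 0
  · subst ha0
    exact (hnc (h.card_le_of_left_eq_zero hb)).elim
  by_cases hb0 : b = 0
  · subst hb0
    exact (hnc (h.card_le_of_right_eq_zero h1 h2 ha0 hd)).elim
  exact IsTriangulated.exists_third h ⟨h1, h2, hb, ha0, hb0, hd, hne⟩ hc

set_option maxHeartbeats 1000000 in
/-- The Gram matrix is determined by its first three rows. -/
theorem IsTriangle.gram_eq {b : ℝ} (hb : 9 * b ^ 2 = 5) {x : Fin 3 → EuclideanSpace ℝ (Fin 3)}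
    (h : IsTriangle (1 / 3) x) {X : Fin 10 → EuclideanSpace ℝ (Fin 3)}
    (hX : ∀ (r : Fin 3) (s : Fin 10), Inner.inner ℝ (x r) (X s) =
      dodecahedronMatrix (1 / 3) b (Fin.castLE (by norm_num) r) s) :
    Matrix.gram ℝ X = dodecahedronMatrix (1 / 3) b := by
  have hbb : b * b = 5 / 9 := by linarith
  ext i j
  rw [Matrix.gram_apply]
  have := h.inner_formula (by norm_num) (fun r => hX r i) (fun r => hX r j)
  generalize Inner.inner ℝ (X i) (X j) = g at this ⊢
  fin_cases i <;> fin_cases j <;> simp [dodecahedronMatrix] at this ⊢ <;> linarith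

/-- A system of at least ten lines containing a triangle of cosine `1 / 3` is dodecahedral. -/
theorem IsTriangulated.exists_gram_eq {ι : Type*} [Fintype ι]
    {y : ι → EuclideanSpace ℝ (Fin 3)} {e : Fin 3 → ι} {x : Fin 3 → EuclideanSpace ℝ (Fin 3)}
    (h : IsTriangulated (1 / 3) (√5 / 3) y e x) (hc : 10 ≤ Fintype.card ι) :
    Fintype.card ι = 10 ∧ ∃ (f : Fin 10 → ι) (X : Fin 10 → EuclideanSpace ℝ (Fin 3)),
      (∀ r, X r = y (f r) ∨ X r = -y (f r)) ∧
      Matrix.gram ℝ X = dodecahedronMatrix (1 / 3) (√5 / 3) := by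
  have hb : 9 * (√5 / 3) ^ 2 = 5 := by
    rw [div_pow, Real.sq_sqrt (by norm_num)]; norm_num
  obtain ⟨m, z, U, hz, hm, hU, hcU, hUl⟩ := h.exists_isCodeSystem isAnglePair_third
  have hsub : U ⊆ Finset.univ.filter fun k => codeType k = 4 ∨ codeType k = 8 := fun k hk => by
    simpa using hU.mem_of_third (by norm_num) hb hk
  have h7 : (Finset.univ.filter fun k => codeType k = 4 ∨ codeType k = 8).card = 7 := by decide
  -- Seven triples are admissible and at least seven are used, so all of them occur.
  have hUeq := Finset.eq_of_subset_of_card_le hsub (by omega)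
  refine ⟨by rw [← hcU, hUeq, h7], ?_⟩
  have hl (k : Fin 32) (hk : codeType k = 4 ∨ codeType k = 8) :
      ∃ l, ∀ r, inner ℝ (x r) (z l) = codeVec (1 / 3) (√5 / 3) k r := by
    obtain ⟨l, hl, rfl⟩ := hUl k (by rw [hUeq]; simpa using hk)
    exact ⟨l, hm l hl⟩
  -- The order and the signs below are read off from columns 3 to 9 of the first three rows of
  -- `dodecahedronMatrix`.
  obtain ⟨l3, h3⟩ := hl 10 (by decide)
  obtain ⟨l4, h4⟩ := hl 13 (by decide)
  obtain ⟨l5, h5⟩ := hl 15 (by decide)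
  obtain ⟨l6, h6⟩ := hl 12 (by decide)
  obtain ⟨l7, h7⟩ := hl 11 (by decide)
  obtain ⟨l8, h8⟩ := hl 14 (by decide)
  obtain ⟨l9, h9⟩ := hl 28 (by decide)
  refine ⟨![e 0, e 1, e 2, l3, l4, l5, l6, l7, l8, l9],
    ![x 0, x 1, x 2, z l3, -z l4, z l5, -z l6, z l7, z l8, z l9], fun r => ?_,
    h.triangle.gram_eq hb fun r s => ?_⟩
  · have neg {v w : EuclideanSpace ℝ (Fin 3)} (h : v = w ∨ v = -w) : -v = w ∨ -v = -w := by
      rcases h with rfl | rfl <;> simp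
    fin_cases r
    exacts [h.sign 0, h.sign 1, h.sign 2, hz l3, neg (hz l4), hz l5, neg (hz l6), hz l7, hz l8,
      hz l9]
  · fin_cases s <;>
      simp only [Fin.reduceFinMk, Matrix.cons_val, inner_neg_right, h.triangle.inner_eq, h3, h4,
        h5, h6, h7, h8, h9, codeVec] <;>
      fin_cases r <;> simp [dodecahedronMatrix, code, symVal]

/-- Congruent triangles are related by an isometry. -/
theorem IsTriangle.exists_isometry {a : ℝ} {x x' : Fin 3 → EuclideanSpace ℝ (Fin 3)}
    (h : IsTriangle a x) (h' : IsTriangle a x') (ha : (1 - a) * (1 + 2 * a) ≠ 0) :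
    ∃ O : EuclideanSpace ℝ (Fin 3) ≃ₗᵢ[ℝ] EuclideanSpace ℝ (Fin 3), ∀ r, O (x r) = x' r := by
  have hdet : (1 - a) ^ 2 * (1 + 2 * a) ≠ 0 := by
    have := left_ne_zero_of_mul ha
    have := right_ne_zero_of_mul ha
    positivity
  have hx := Matrix.linearIndependent_of_det_gram_ne_zero (by rw [h.det_gram]; exact hdet)
  have hx' := Matrix.linearIndependent_of_det_gram_ne_zero (by rw [h'.det_gram]; exact hdet)
  set B := basisOfLinearIndependentOfCardEqFinrank hx (by simp) with hB
  set B' := basisOfLinearIndependentOfCardEqFinrank hx' (by simp) with hB'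
  have hBx (r : Fin 3) : B r = x r := by simp [hB]
  have hBx' (r : Fin 3) : B' r = x' r := by simp [hB']
  set L := B.equiv B' (Equiv.refl _) with hL
  have hLx (r : Fin 3) : L (B r) = B' r := by simp [hL]
  have hin : (innerₗ (EuclideanSpace ℝ (Fin 3))).compl₁₂ (L : _ →ₗ[ℝ] _) (L : _ →ₗ[ℝ] _) =
      innerₗ (EuclideanSpace ℝ (Fin 3)) := by
    refine LinearMap.ext_basis B B fun i j => ?_
    simp only [LinearMap.compl₁₂_apply, LinearEquiv.coe_coe, innerₗ_apply_apply, hLx]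
    rw [hBx, hBx, hBx', hBx', h.inner_eq, h'.inner_eq]
  refine ⟨L.isometryOfInner fun u v => LinearMap.congr_fun₂ hin u v, fun r => ?_⟩
  rw [← hBx, ← hBx', ← hLx]
  rfl

theorem isTriangle_of_inner_eq {b : ℝ} {x : Fin 3 → EuclideanSpace ℝ (Fin 3)}
    (h : ∀ r s, inner ℝ (x r) (x s) = dodecahedronMatrix (1 / 3) b
      (Fin.castLE (by norm_num) r) (Fin.castLE (by norm_num) s)) : IsTriangle (1 / 3) x := by
  constructor
  · intro i
    have := h i i
    rw [real_inner_self_eq_norm_sq] at this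
    rw [← pow_eq_one_iff_of_nonneg (norm_nonneg _) two_ne_zero, this]
    fin_cases i <;> simp [dodecahedronMatrix]
  · intro i j hij
    rw [h]
    fin_cases i <;> fin_cases j <;> simp [dodecahedronMatrix] at hij ⊢

theorem isTriangle_of_gram_eq {b : ℝ} {X : Fin 10 → EuclideanSpace ℝ (Fin 3)}
    (h : Matrix.gram ℝ X = dodecahedronMatrix (1 / 3) b) :
    IsTriangle (1 / 3) fun r : Fin 3 => X (Fin.castLE (by norm_num) r) :=
  isTriangle_of_inner_eq fun r s => by rw [← h, Matrix.gram_apply]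

/-- An isometry matching the first three vectors matches all ten, because the others are determined
by their inner products with these. -/
theorem exists_isometry_of_gram_eq {b : ℝ} {X X' : Fin 10 → EuclideanSpace ℝ (Fin 3)}
    (h : Matrix.gram ℝ X = dodecahedronMatrix (1 / 3) b)
    (h' : Matrix.gram ℝ X' = dodecahedronMatrix (1 / 3) b) :
    ∃ O : EuclideanSpace ℝ (Fin 3) ≃ₗᵢ[ℝ] EuclideanSpace ℝ (Fin 3), ∀ r, O (X r) = X' r := by
  have ht' := isTriangle_of_gram_eq h'
  obtain ⟨O, hO⟩ := (isTriangle_of_gram_eq h).exists_isometry ht' (by norm_num)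
  refine ⟨O, fun s => ht'.ext_inner (by norm_num) fun r => ?_⟩
  rw [← hO, O.inner_map_map, hO, ← Matrix.gram_apply, ← Matrix.gram_apply, h, h']

/-! ### The dodecahedron realizes the Gram matrix. -/

/-- One vertex of the dodecahedron on each of its ten main diagonals. -/
noncomputable def dodecahedronHalf : Fin 10 → EuclideanSpace ℝ (Fin 3) :=
  let p := Real.goldenRatio
  let q := Real.goldenRatio⁻¹
  ![!₂[1, 1, 1], !₂[1, 1, -1], !₂[-q, p, 0], !₂[-1, 1, 1], !₂[1, -1, 1], !₂[p, 0, -q],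
    !₂[0, -q, p], !₂[p, 0, q], !₂[0, q, p], !₂[q, p, 0]]

theorem dodecahedronHalf_mem (r : Fin 10) : dodecahedronHalf r ∈ dodecahedronVertices := by
  have three {P : Fin 3 → Prop} (h0 : P 0) (h1 : P 1) (h2 : P 2) (i : Fin 3) : P i := by
    fin_cases i <;> assumption
  fin_cases r
  · exact Or.inl (by apply three <;> simp [dodecahedronHalf])
  · exact Or.inl (by apply three <;> simp [dodecahedronHalf])
  · exact Or.inr ⟨2, by simp [dodecahedronHalf]⟩
  · exact Or.inl (by apply three <;> simp [dodecahedronHalf])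
  · exact Or.inl (by apply three <;> simp [dodecahedronHalf])
  · exact Or.inr ⟨1, by simp [dodecahedronHalf]⟩
  · exact Or.inr ⟨0, by simp [dodecahedronHalf]⟩
  · exact Or.inr ⟨1, by simp [dodecahedronHalf]⟩
  · exact Or.inr ⟨0, by simp [dodecahedronHalf]⟩
  · exact Or.inr ⟨2, by simp [dodecahedronHalf]⟩

theorem exists_dodecahedronHalf {v : EuclideanSpace ℝ (Fin 3)} (hv : v ∈ dodecahedronVertices) :
    ∃ r, v = dodecahedronHalf r ∨ v = -dodecahedronHalf r := by
  have pos (r : Fin 10) (h0 : v 0 = dodecahedronHalf r 0) (h1 : v 1 = dodecahedronHalf r 1)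
      (h2 : v 2 = dodecahedronHalf r 2) : ∃ r, v = dodecahedronHalf r ∨ v = -dodecahedronHalf r :=
    ⟨r, Or.inl (by ext i; fin_cases i <;> assumption)⟩
  have neg (r : Fin 10) (h0 : v 0 = -dodecahedronHalf r 0) (h1 : v 1 = -dodecahedronHalf r 1)
      (h2 : v 2 = -dodecahedronHalf r 2) : ∃ r, v = dodecahedronHalf r ∨ v = -dodecahedronHalf r :=
    ⟨r, Or.inr (by ext i; fin_cases i <;> assumption)⟩
  rcases hv with hv | ⟨i, h0, h1, h2⟩
  · rcases hv 0 with h0 | h0 <;> rcases hv 1 with h1 | h1 <;> rcases hv 2 with h2 | h2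
    · refine pos 0 ?_ ?_ ?_ <;> simp [h0, h1, h2, dodecahedronHalf]
    · refine pos 1 ?_ ?_ ?_ <;> simp [h0, h1, h2, dodecahedronHalf]
    · refine pos 4 ?_ ?_ ?_ <;> simp [h0, h1, h2, dodecahedronHalf]
    · refine neg 3 ?_ ?_ ?_ <;> simp [h0, h1, h2, dodecahedronHalf]
    · refine pos 3 ?_ ?_ ?_ <;> simp [h0, h1, h2, dodecahedronHalf]
    · refine neg 4 ?_ ?_ ?_ <;> simp [h0, h1, h2, dodecahedronHalf]
    · refine neg 1 ?_ ?_ ?_ <;> simp [h0, h1, h2, dodecahedronHalf]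
    · refine neg 0 ?_ ?_ ?_ <;> simp [h0, h1, h2, dodecahedronHalf]
  · fin_cases i <;> simp at h0 h1 h2 <;> rcases h1 with h1 | h1 <;> rcases h2 with h2 | h2
    · refine pos 8 ?_ ?_ ?_ <;> simp [h0, h1, h2, dodecahedronHalf]
    · refine neg 6 ?_ ?_ ?_ <;> simp [h0, h1, h2, dodecahedronHalf]
    · refine pos 6 ?_ ?_ ?_ <;> simp [h0, h1, h2, dodecahedronHalf]
    · refine neg 8 ?_ ?_ ?_ <;> simp [h0, h1, h2, dodecahedronHalf]
    · refine pos 7 ?_ ?_ ?_ <;> simp [h0, h1, h2, dodecahedronHalf]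
    · refine neg 5 ?_ ?_ ?_ <;> simp [h0, h1, h2, dodecahedronHalf]
    · refine pos 5 ?_ ?_ ?_ <;> simp [h0, h1, h2, dodecahedronHalf]
    · refine neg 7 ?_ ?_ ?_ <;> simp [h0, h1, h2, dodecahedronHalf]
    · refine pos 9 ?_ ?_ ?_ <;> simp [h0, h1, h2, dodecahedronHalf]
    · refine neg 2 ?_ ?_ ?_ <;> simp [h0, h1, h2, dodecahedronHalf]
    · refine pos 2 ?_ ?_ ?_ <;> simp [h0, h1, h2, dodecahedronHalf]
    · refine neg 9 ?_ ?_ ?_ <;> simp [h0, h1, h2, dodecahedronHalf]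

theorem span_singleton_eq_of_sign {v w : EuclideanSpace ℝ (Fin 3)} (h : v = w ∨ v = -w) :
    Submodule.span ℝ {v} = Submodule.span ℝ {w} := by
  rcases h with rfl | rfl
  · rfl
  · rw [← Set.neg_singleton, Submodule.span_neg]

theorem dodecahedronDiagonals_eq :
    dodecahedronDiagonals = Set.range fun r => Submodule.span ℝ {dodecahedronHalf r} := by
  ext S
  constructor
  · rintro ⟨v, hv, rfl⟩
    obtain ⟨r, hr⟩ := exists_dodecahedronHalf hv
    exact ⟨r, (span_singleton_eq_of_sign hr).symm⟩
  · rintro ⟨r, rfl⟩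
    exact ⟨_, dodecahedronHalf_mem r, rfl⟩

/-- Unit vectors on the main diagonals of the dodecahedron. -/
noncomputable def dodecahedronUnit (r : Fin 10) : EuclideanSpace ℝ (Fin 3) := (√3)⁻¹ • dodecahedronHalf r

theorem inner_dodecahedronUnit (r s : Fin 10) :
    inner ℝ (dodecahedronUnit r) (dodecahedronUnit s) =
      1 / 3 * (dodecahedronHalf r 0 * dodecahedronHalf s 0 +
        dodecahedronHalf r 1 * dodecahedronHalf s 1 +
        dodecahedronHalf r 2 * dodecahedronHalf s 2) := by
  rw [dodecahedronUnit, dodecahedronUnit, real_inner_smul_left, inner_smul_right, ← mul_assoc,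
    ← mul_inv, Real.mul_self_sqrt (by norm_num), PiLp.inner_apply, Fin.sum_univ_three]
  simp [mul_comm]

/-- Only three rows are computed with the golden ratio; `IsTriangle.gram_eq` supplies the rest. -/
theorem gram_dodecahedronUnit :
    Matrix.gram ℝ dodecahedronUnit = dodecahedronMatrix (1 / 3) (√5 / 3) := by
  have h5 : √5 ^ 2 = 5 := Real.sq_sqrt (by norm_num)
  have hp : Real.goldenRatio = (1 + √5) / 2 := rfl
  have hq : Real.goldenRatio⁻¹ = (√5 - 1) / 2 := by
    rw [Real.inv_goldenRatio, Real.goldenConj]; ring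
  have hX (r : Fin 3) (s : Fin 10) :
      inner ℝ (dodecahedronUnit (Fin.castLE (by norm_num) r)) (dodecahedronUnit s) =
        dodecahedronMatrix (1 / 3) (√5 / 3) (Fin.castLE (by norm_num) r) s := by
    rw [inner_dodecahedronUnit]
    simp only [dodecahedronHalf, hq]
    rw [hp]
    fin_cases r <;> fin_cases s <;> simp [dodecahedronMatrix] <;> linarith
  refine IsTriangle.gram_eq (x := fun r => dodecahedronUnit (Fin.castLE (by norm_num) r)) ?_
    (isTriangle_of_inner_eq fun r s => hX r _) hX
  rw [div_pow, h5]
  norm_num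

/-! ### Candidate Gram matrices and relabelings. -/

theorem dodecahedronMatrix_mem {R : Type} [CommRing R] (a b : R) {i j : Fin 10} (h : i ≠ j) :
    dodecahedronMatrix a b i j = a ∨ dodecahedronMatrix a b i j = b ∨
      dodecahedronMatrix a b i j = -a ∨ dodecahedronMatrix a b i j = -b := by
  fin_cases i <;> fin_cases j <;> first | exact absurd rfl h | simp [dodecahedronMatrix]

theorem dodecahedronMatrix_sq (a b : ℝ) {i j : Fin 10} (h : i ≠ j) :
    dodecahedronMatrix a b i j ^ 2 = a ^ 2 ∨ dodecahedronMatrix a b i j ^ 2 = b ^ 2 := by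
  rcases dodecahedronMatrix_mem a b h with h | h | h | h <;> rw [h] <;> simp

theorem dodecahedronMatrix_diag {R : Type} [CommRing R] (a b : R) (i : Fin 10) :
    dodecahedronMatrix a b i i = 1 := by
  fin_cases i <;> rfl

theorem dodecahedronMatrix_comm {R : Type} [CommRing R] (a b : R) (i j : Fin 10) :
    dodecahedronMatrix a b i j = dodecahedronMatrix a b j i := by
  fin_cases i <;> fin_cases j <;> rfl

theorem map_dodecahedronMatrix {R S : Type} [CommRing R] [CommRing S] (f : R →+* S) (a b : R)
    (i j : Fin 10) :
    f (dodecahedronMatrix a b i j) = dodecahedronMatrix (f a) (f b) i j := by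
  fin_cases i <;> fin_cases j <;> simp [dodecahedronMatrix]

theorem aeval_symA {R : Type} [CommRing R] [Algebra ℚ R] (a b : R) :
    MvPolynomial.aeval ![a, b] symA = a := by simp [symA]

theorem aeval_symB {R : Type} [CommRing R] [Algebra ℚ R] (a b : R) :
    MvPolynomial.aeval ![a, b] symB = b := by simp [symB]

theorem substSymbols_dodecahedronCandidate {R : Type} [CommRing R] [Algebra ℚ R] (a b : R) :
    substSymbols dodecahedronCandidate a b = dodecahedronMatrix a b := by
  ext i j
  have := map_dodecahedronMatrix (MvPolynomial.aeval (R := ℚ) ![a, b] : SymbolRing →ₐ[ℚ] R).toRingHom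
    symA symB i j
  simp only [AlgHom.toRingHom_eq_coe, RingHom.coe_coe, aeval_symA, aeval_symB] at this
  exact this

theorem neg_mem_symbolSet {s : SymbolRing} (h : s ∈ symbolSet) : -s ∈ symbolSet := by
  rcases h with rfl | rfl | rfl | rfl <;> simp [symbolSet]

theorem sq_aeval_of_mem {s : SymbolRing} (h : s ∈ symbolSet) (a b : ℝ) :
    MvPolynomial.aeval ![a, b] s ^ 2 = a ^ 2 ∨ MvPolynomial.aeval ![a, b] s ^ 2 = b ^ 2 := by
  rcases h with rfl | rfl | rfl | rfl <;> simp [aeval_symA, aeval_symB]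

theorem zero_notMem_symbolSet : (0 : SymbolRing) ∉ symbolSet := by
  intro h
  have := sq_aeval_of_mem h 1 1
  simp at this

/-- This lifts an identity between real Gram matrices to an identity between matrices of symbols. -/
theorem aeval_injOn {a b : ℝ} (ha : a ≠ 0) (hb : b ≠ 0) (hab : a ^ 2 ≠ b ^ 2) {s t : SymbolRing}
    (hs : s ∈ symbolSet) (ht : t ∈ symbolSet)
    (h : MvPolynomial.aeval ![a, b] s = MvPolynomial.aeval ![a, b] t) : s = t := by
  have h1 : a ≠ b := by rintro rfl; exact hab rfl
  have h2 : a ≠ -b := by rintro rfl; exact hab (neg_sq b)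
  rcases hs with rfl | rfl | rfl | rfl <;> rcases ht with rfl | rfl | rfl | rfl <;>
    simp only [map_neg, aeval_symA, aeval_symB] at h <;> first
    | rfl
    | exact absurd h h1
    | exact absurd h.symm h1
    | exact absurd h h2
    | exact absurd h.symm h2
    | exact absurd (by linarith) ha
    | exact absurd (by linarith) hb
    | exact absurd (by linarith) h1
    | exact absurd (by linarith) h2

theorem exists_symbol {a b p : ℝ} (h : a ^ 2 = p ^ 2 ∨ b ^ 2 = p ^ 2) :
    ∃ s ∈ symbolSet, MvPolynomial.aeval ![a, b] s = p := by
  rcases h with h | h <;> rcases sq_eq_sq_iff_eq_or_eq_neg.1 h with h | h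
  · exact ⟨symA, by simp [symbolSet], by rw [aeval_symA, h]⟩
  · exact ⟨-symA, by simp [symbolSet], by rw [map_neg, aeval_symA, h, neg_neg]⟩
  · exact ⟨symB, by simp [symbolSet], by rw [aeval_symB, h]⟩
  · exact ⟨-symB, by simp [symbolSet], by rw [map_neg, aeval_symB, h, neg_neg]⟩

theorem dodecahedronMatrix_mem_symbolSet {s t : SymbolRing} (hs : s ∈ symbolSet)
    (ht : t ∈ symbolSet) {i j : Fin 10} (h : i ≠ j) : dodecahedronMatrix s t i j ∈ symbolSet := by
  rcases dodecahedronMatrix_mem s t h with h | h | h | h <;> rw [h]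
  exacts [hs, ht, neg_mem_symbolSet hs, neg_mem_symbolSet ht]

theorem units_mul_mem_symbolSet (ε : ℤˣ) {s : SymbolRing} (hs : s ∈ symbolSet) :
    ((ε : ℤ) : SymbolRing) * s ∈ symbolSet := by
  rcases Int.units_eq_one_or ε with rfl | rfl
  · simpa using hs
  · simpa using neg_mem_symbolSet hs

theorem units_mul_self_cast {R : Type} [CommRing R] (ε : ℤˣ) :
    ((ε : ℤ) : R) * ((ε : ℤ) : R) = 1 := by
  rcases Int.units_eq_one_or ε with rfl | rfl <;> simp

/-- Values of the two symbols for which a relabeling gives prescribed values. -/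
theorem IsRelabeling.exists_values {s t : SymbolRing} (h : IsRelabeling s t) (p q : ℝ) :
    ∃ a b : ℝ, MvPolynomial.aeval ![a, b] s = p ∧ MvPolynomial.aeval ![a, b] t = q ∧
      ((a ^ 2 = p ^ 2 ∧ b ^ 2 = q ^ 2) ∨ (a ^ 2 = q ^ 2 ∧ b ^ 2 = p ^ 2)) := by
  obtain ⟨hs, ht, h1, h2⟩ := h
  rcases hs with rfl | rfl | rfl | rfl <;> rcases ht with rfl | rfl | rfl | rfl <;> first
    | exact absurd rfl h1
    | exact absurd rfl h2
    | exact absurd (neg_neg _).symm h2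
    | (refine ⟨p, q, ?_⟩; simp [aeval_symA, aeval_symB]; done)
    | (refine ⟨-p, q, ?_⟩; simp [aeval_symA, aeval_symB]; done)
    | (refine ⟨p, -q, ?_⟩; simp [aeval_symA, aeval_symB]; done)
    | (refine ⟨-p, -q, ?_⟩; simp [aeval_symA, aeval_symB]; done)
    | (refine ⟨q, p, ?_⟩; simp [aeval_symA, aeval_symB]; done)
    | (refine ⟨-q, p, ?_⟩; simp [aeval_symA, aeval_symB]; done)
    | (refine ⟨q, -p, ?_⟩; simp [aeval_symA, aeval_symB]; done)
    | (refine ⟨-q, -p, ?_⟩; simp [aeval_symA, aeval_symB])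

/-- A matrix equivalent to the dodecahedral one is a candidate Gram matrix. -/
theorem isCandidateGram_of_equiv {C : Matrix (Fin 10) (Fin 10) SymbolRing}
    (h : CandidateEquiv C dodecahedronCandidate) : IsCandidateGram C := by
  obtain ⟨π, ε, s, t, hst, hC⟩ := h
  simp only [substSymbols_dodecahedronCandidate] at hC
  have hmem (i j : Fin 10) (hij : i ≠ j) : C i j ∈ symbolSet := by
    rw [hC, mul_assoc]
    exact units_mul_mem_symbolSet _ (units_mul_mem_symbolSet _
      (dodecahedronMatrix_mem_symbolSet hst.1 hst.2.1 (π.injective.ne hij)))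
  refine ⟨?_, fun i => ?_, fun i j hij => Or.inr (hmem i j hij), ?_⟩
  · ext i j
    rw [Matrix.transpose_apply, hC, hC, dodecahedronMatrix_comm s t (π j) (π i),
      mul_comm ((ε j : ℤ) : SymbolRing)]
  · rw [hC, dodecahedronMatrix_diag, mul_one, units_mul_self_cast]
  · rintro ⟨⟨i, j, hij, h0⟩, -⟩
    exact zero_notMem_symbolSet (h0 ▸ hmem i j hij)

/-- A candidate Gram matrix taking the values of the dodecahedral Gram matrix is equivalent to the
dodecahedral candidate. -/
theorem candidateEquiv_of_eq {C : Matrix (Fin 10) (Fin 10) SymbolRing} (hC : IsCandidateGram C)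
    {a b p q : ℝ} (hp : p ≠ 0) (hq : q ≠ 0) (hpq : p ^ 2 ≠ q ^ 2) (π : Equiv.Perm (Fin 10))
    (ε : Fin 10 → ℤˣ)
    (h : ∀ i j, substSymbols C a b i j =
      ((ε i : ℤ) : ℝ) * ((ε j : ℤ) : ℝ) * dodecahedronMatrix p q (π i) (π j)) :
    CandidateEquiv C dodecahedronCandidate := by
  have hev (i j) : MvPolynomial.aeval ![a, b] (C i j) =
      ((ε i : ℤ) : ℝ) * ((ε j : ℤ) : ℝ) * dodecahedronMatrix p q (π i) (π j) := h i j
  have hsq (i j) : MvPolynomial.aeval ![a, b] (C i j) ^ 2 =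
      dodecahedronMatrix p q (π i) (π j) ^ 2 := by
    rw [hev, mul_pow, mul_pow, sq ((ε i : ℤ) : ℝ), sq ((ε j : ℤ) : ℝ), units_mul_self_cast,
      units_mul_self_cast, one_mul, one_mul]
  have hmem (i j) (hij : i ≠ j) : C i j ∈ symbolSet := by
    refine (hC.2.2.1 i j hij).resolve_left fun h0 => ?_
    have := hsq i j
    rw [h0, map_zero, zero_pow two_ne_zero] at this
    rcases dodecahedronMatrix_sq p q (π.injective.ne hij) with e | e <;> rw [e] at this
    · exact hp (pow_eq_zero_iff two_ne_zero |>.1 this.symm)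
    · exact hq (pow_eq_zero_iff two_ne_zero |>.1 this.symm)
  have hval (k l : Fin 10) (hkl : k ≠ l) : a ^ 2 = dodecahedronMatrix p q k l ^ 2 ∨
      b ^ 2 = dodecahedronMatrix p q k l ^ 2 := by
    have h1 := hsq (π.symm k) (π.symm l)
    rw [π.apply_symm_apply, π.apply_symm_apply] at h1
    rw [← h1]
    exact (sq_aeval_of_mem (hmem _ _ (π.symm.injective.ne hkl)) a b).imp Eq.symm Eq.symm
  -- The entries at `(0, 1)` and `(0, 7)` are `p` and `q`, so `a²`, `b²` are `p²`, `q²` in some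
  -- order.
  have hvp : a ^ 2 = p ^ 2 ∨ b ^ 2 = p ^ 2 := hval 0 1 (by decide)
  have hvq : a ^ 2 = q ^ 2 ∨ b ^ 2 = q ^ 2 := hval 0 7 (by decide)
  have hab : a ≠ 0 ∧ b ≠ 0 ∧ a ^ 2 ≠ b ^ 2 := by
    have hp2 := pow_ne_zero 2 hp
    have hq2 := pow_ne_zero 2 hq
    have : a ^ 2 ≠ 0 ∧ b ^ 2 ≠ 0 ∧ a ^ 2 ≠ b ^ 2 := by
      rcases hvp with e | e <;> rcases hvq with e' | e'
      · exact absurd (e.symm.trans e') hpq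
      · rw [e, e']; exact ⟨hp2, hq2, hpq⟩
      · rw [e, e']; exact ⟨hq2, hp2, hpq.symm⟩
      · exact absurd (e.symm.trans e') hpq
    simpa using this
  -- The relabeling consists of the symbols whose values at `(a, b)` are `p` and `q`.
  obtain ⟨s, hs, hsp⟩ := exists_symbol hvp
  obtain ⟨t, ht, htq⟩ := exists_symbol hvq
  refine ⟨π, ε, s, t, ⟨hs, ht, ?_, ?_⟩, fun i j => ?_⟩
  · rintro rfl
    exact hpq (by rw [← hsp, ← htq])
  · rintro rfl
    rw [map_neg, htq] at hsp
    exact hpq (by rw [← hsp, neg_sq])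
  · rw [substSymbols_dodecahedronCandidate]
    by_cases hij : i = j
    · subst hij
      rw [hC.2.1, dodecahedronMatrix_diag, mul_one, units_mul_self_cast]
    · refine aeval_injOn hab.1 hab.2.1 hab.2.2 (hmem i j hij) ?_ ?_
      · rw [mul_assoc]
        exact units_mul_mem_symbolSet _ (units_mul_mem_symbolSet _
          (dodecahedronMatrix_mem_symbolSet hs ht (π.injective.ne hij)))
      · have := map_dodecahedronMatrix
          (MvPolynomial.aeval (R := ℚ) ![a, b] : SymbolRing →ₐ[ℚ] ℝ).toRingHom s t (π i) (π j)
        simp only [AlgHom.toRingHom_eq_coe, RingHom.coe_coe, hsp, htq] at this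
        rw [hev, map_mul, map_mul, this, map_intCast, map_intCast]

/-! ### The bound on the cardinality. -/

theorem innerProducts_mono {d : ℕ} {X Y : Set (EuclideanSpace ℝ (Fin d))} (h : X ⊆ Y) :
    innerProducts X ⊆ innerProducts Y := by
  rintro c ⟨x, hx, y, hy, hne, rfl⟩
  exact ⟨x, h hx, y, h hy, hne, rfl⟩

theorem SpansMultiangularLines.mono {d m : ℕ} {X Y : Set (EuclideanSpace ℝ (Fin d))} (h : X ⊆ Y)
    (hY : SpansMultiangularLines m Y) : SpansMultiangularLines m X :=
  ⟨fun x hx => hY.1 x (h hx), fun hx => hY.2.1 (innerProducts_mono h hx),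
    (Set.encard_le_encard (Set.image_mono (innerProducts_mono h))).trans hY.2.2⟩

theorem sq_inner_lt_one {d m : ℕ} {X : Set (EuclideanSpace ℝ (Fin d))}
    (h : SpansMultiangularLines m X) {c : ℝ} (hc : c ∈ innerProducts X) : c ^ 2 < 1 := by
  have hc1 : c ≠ -1 := fun e => h.2.1 (e ▸ hc)
  obtain ⟨x, hx, y, hy, hne, rfl⟩ := hc
  have h1 : inner ℝ x y ≠ (1 : ℝ) := fun e =>
    hne ((inner_eq_one_iff_of_norm_eq_one (h.1 x hx) (h.1 y hy)).1 e)
  have h2 := abs_le.1 (abs_real_inner_le_norm x y)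
  rw [h.1 x hx, h.1 y hy, mul_one] at h2
  rw [sq_lt_one_iff_abs_lt_one, abs_lt]
  exact ⟨lt_of_le_of_ne h2.1 hc1.symm, lt_of_le_of_ne h2.2 h1⟩

/-- When fewer than two squares occur, the list is padded by `0` or `1/2` so that two distinct
values are always available. -/
theorem exists_sq_of_encard_le_two {S : Set ℝ} (h : S.encard ≤ 2) (h0 : ∀ c ∈ S, 0 ≤ c ∧ c < 1) :
    ∃ α β : ℝ, α ^ 2 < 1 ∧ β ^ 2 < 1 ∧ α ^ 2 ≠ β ^ 2 ∧ ∀ c ∈ S, c = α ^ 2 ∨ c = β ^ 2 := by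
  rcases h.lt_or_eq with h | h
  · have h1 : S.encard ≤ 1 := by
      rw [← one_add_one_eq_two] at h
      exact Order.le_of_lt_add_one h
    rcases Set.encard_le_one_iff_eq.1 h1 with rfl | ⟨p, rfl⟩
    · exact ⟨0, 1 / 2, by norm_num, by norm_num, by norm_num, by simp⟩
    · obtain ⟨hp0, hp1⟩ := h0 p rfl
      refine ⟨√p, if p = 0 then 1 / 2 else 0, by rwa [Real.sq_sqrt hp0], ?_, ?_, ?_⟩
      · split_ifs <;> norm_num
      · rw [Real.sq_sqrt hp0]
        split_ifs with h
        · rw [h]; norm_num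
        · simpa using h
      · rintro c rfl
        exact Or.inl (Real.sq_sqrt hp0).symm
  · obtain ⟨p, q, hpq, rfl⟩ := Set.encard_eq_two.1 h
    obtain ⟨hp0, hp1⟩ := h0 p (by simp)
    obtain ⟨hq0, hq1⟩ := h0 q (by simp)
    refine ⟨√p, √q, ?_⟩
    rw [Real.sq_sqrt hp0, Real.sq_sqrt hq0]
    exact ⟨hp1, hq1, hpq, by simp⟩

/-- Ten lines, in suitable order and with suitable signs, have the dodecahedral Gram matrix; eleven
lines do not exist. -/
theorem SpansBiangularLines.exists_gram_eq {X : Set (EuclideanSpace ℝ (Fin 3))} [Fintype X]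
    (hX : SpansBiangularLines X) (hc : 10 ≤ Fintype.card X) :
    Fintype.card X = 10 ∧ ∃ (f : Fin 10 → X) (Y : Fin 10 → EuclideanSpace ℝ (Fin 3)),
      (∀ r, Y r = f r ∨ Y r = -f r) ∧
      Matrix.gram ℝ Y = dodecahedronMatrix (1 / 3) (√5 / 3) := by
  obtain ⟨α, β, hα, hβ, hne, hS⟩ := exists_sq_of_encard_le_two hX.2.2 (by
    rintro _ ⟨c, hc, rfl⟩
    exact ⟨sq_nonneg c, sq_inner_lt_one hX hc⟩)
  have hb : IsBiangular α β (fun x : X => (x : EuclideanSpace ℝ (Fin 3))) :=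
    ⟨fun x => hX.1 x x.2, fun x y hxy => hS _ ⟨_, ⟨x, x.2, y, y.2, Subtype.coe_injective.ne hxy, rfl⟩, rfl⟩⟩
  obtain ⟨e, x, h⟩ := hb.exists_third hα hβ hne hc
  exact h.exists_gram_eq hc

theorem encard_le_ten {X : Set (EuclideanSpace ℝ (Fin 3))} (hX : SpansBiangularLines X) :
    X.encard ≤ 10 := by
  by_contra! h
  -- Passing to eleven members makes the set finite, whatever the size of `X`.
  obtain ⟨T, hTX, hT⟩ := Set.exists_subset_encard_eq (Order.add_one_le_of_lt h)
  have hfin : T.Finite := Set.finite_of_encard_eq_coe (k := 11) (by rw [hT]; norm_num)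
  have := hfin.fintype
  have hcard : Fintype.card T = 11 := by
    have h1 := Set.coe_fintypeCard T
    rw [hT] at h1
    have h2 : ((Fintype.card T : ℕ) : ℕ∞) = (11 : ℕ) := by rw [h1]; norm_num
    exact_mod_cast h2
  have := (SpansBiangularLines.exists_gram_eq (hX.mono hTX) (by omega)).1
  omega

/-! ### Consequences for systems of ten lines. -/

section Dodecahedral

variable {Y : Fin 10 → EuclideanSpace ℝ (Fin 3)}

theorem norm_eq_one_of_gram {p q : ℝ} (h : Matrix.gram ℝ Y = dodecahedronMatrix p q) (r : Fin 10) :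
    ‖Y r‖ = 1 := by
  rw [← pow_eq_one_iff_of_nonneg (norm_nonneg _) two_ne_zero, ← real_inner_self_eq_norm_sq,
    ← Matrix.gram_apply (𝕜 := ℝ), h, dodecahedronMatrix_diag]

theorem sq_third : (√5 / 3) ^ 2 = 5 / 9 := by
  rw [div_pow, Real.sq_sqrt (by norm_num)]; norm_num

theorem sq_inner_of_gram (h : Matrix.gram ℝ Y = dodecahedronMatrix (1 / 3) (√5 / 3)) {r s : Fin 10}
    (hrs : r ≠ s) : inner ℝ (Y r) (Y s) ^ 2 = 1 / 9 ∨ inner ℝ (Y r) (Y s) ^ 2 = 5 / 9 := by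
  rw [← Matrix.gram_apply, h]
  have := dodecahedronMatrix_sq (1 / 3) (√5 / 3) hrs
  rwa [sq_third, show (1 / 3 : ℝ) ^ 2 = 1 / 9 by norm_num] at this

theorem not_sign_of_gram (h : Matrix.gram ℝ Y = dodecahedronMatrix (1 / 3) (√5 / 3)) {r s : Fin 10}
    (hrs : r ≠ s) : ¬(Y r = Y s ∨ Y r = -Y s) := by
  intro hs
  have h1 := inner_sq_of_sign hs (Or.inl rfl : Y s = Y s ∨ Y s = -Y s)
  rw [real_inner_self_eq_norm_sq, norm_eq_one_of_gram h] at h1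
  rcases sq_inner_of_gram h hrs with h2 | h2 <;> rw [h1] at h2 <;> norm_num at h2

theorem sign_of_span_eq {v w : EuclideanSpace ℝ (Fin 3)} (hv : ‖v‖ = 1) (hw : ‖w‖ = 1)
    (h : Submodule.span ℝ {v} = Submodule.span ℝ {w}) : v = w ∨ v = -w := by
  obtain ⟨z, hz⟩ := Submodule.mem_span_singleton.1 (h ▸ Submodule.mem_span_singleton_self v)
  have h1 : |z| = 1 := by
    have := congrArg norm hz
    rwa [norm_smul, hv, hw, mul_one, Real.norm_eq_abs] at this
  rcases eq_or_eq_neg_of_abs_eq h1 with rfl | rfl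
  · left; rw [← hz, one_smul]
  · right; rw [← hz, neg_one_smul]

theorem span_injective_of_gram (h : Matrix.gram ℝ Y = dodecahedronMatrix (1 / 3) (√5 / 3)) :
    Function.Injective fun r => Submodule.span ℝ {Y r} := by
  intro r s hrs
  by_contra hne
  exact not_sign_of_gram h hne
    (sign_of_span_eq (norm_eq_one_of_gram h r) (norm_eq_one_of_gram h s) hrs)

theorem spansBiangularLines_range (h : Matrix.gram ℝ Y = dodecahedronMatrix (1 / 3) (√5 / 3)) :
    SpansBiangularLines (Set.range Y) := by
  have hin : ∀ c ∈ innerProducts (Set.range Y), c ^ 2 = 1 / 9 ∨ c ^ 2 = 5 / 9 := by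
    rintro c ⟨_, ⟨r, rfl⟩, _, ⟨s, rfl⟩, hne, rfl⟩
    exact sq_inner_of_gram h fun e => hne (by rw [e])
  refine ⟨?_, fun h1 => ?_, ?_⟩
  · rintro _ ⟨r, rfl⟩
    exact norm_eq_one_of_gram h r
  · rcases hin _ h1 with e | e <;> norm_num at e
  · refine (Set.encard_le_encard (t := {1 / 9, 5 / 9}) ?_).trans ((Set.encard_insert_le _ _).trans (by rw [Set.encard_singleton, one_add_one_eq_two]; rfl))
    rintro _ ⟨c, hc, rfl⟩
    exact hin c hc

theorem encard_range (h : Matrix.gram ℝ Y = dodecahedronMatrix (1 / 3) (√5 / 3)) :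
    (Set.range Y).encard = 10 := by
  have hinj : Function.Injective Y := fun r s hrs =>
    span_injective_of_gram h (congrArg (fun v => Submodule.span ℝ {v}) hrs)
  rw [← Set.image_univ, hinj.encard_image, Set.encard_univ]
  simp

/-- A set of unit vectors on the lines spanned by vectors with the dodecahedral Gram matrix. -/
structure IsDodecahedral (X : Set (EuclideanSpace ℝ (Fin 3)))
    (Y : Fin 10 → EuclideanSpace ℝ (Fin 3)) : Prop where
  gram : Matrix.gram ℝ Y = dodecahedronMatrix (1 / 3) (√5 / 3)
  sign : ∀ r, ∃ x ∈ X, Y r = x ∨ Y r = -x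
  surj : ∀ x ∈ X, ∃ r, Y r = x ∨ Y r = -x

theorem SpansBiangularLines.exists_isDodecahedral {X : Set (EuclideanSpace ℝ (Fin 3))}
    (hX : SpansBiangularLines X) (hc : X.encard = 10) : ∃ Y, IsDodecahedral X Y := by
  have hfin : X.Finite := Set.finite_of_encard_eq_coe (k := 10) (by rw [hc]; norm_num)
  have := hfin.fintype
  have hcard : Fintype.card X = 10 := by
    have h1 := Set.coe_fintypeCard X
    rw [hc] at h1
    have h2 : ((Fintype.card X : ℕ) : ℕ∞) = (10 : ℕ) := by rw [h1]; norm_num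
    exact_mod_cast h2
  obtain ⟨-, f, Y, hf, hY⟩ := hX.exists_gram_eq hcard.ge
  refine ⟨Y, hY, fun r => ⟨f r, (f r).2, hf r⟩, fun x hx => ?_⟩
  have hinj : Function.Injective f := by
    intro r s hrs
    by_contra hne
    refine not_sign_of_gram hY hne ?_
    rcases hf r with h1 | h1 <;> rcases hf s with h2 | h2 <;> rw [h1, h2, hrs] <;> simp
  obtain ⟨r, hr⟩ := ((Fintype.bijective_iff_injective_and_card f).2
    ⟨hinj, by rw [hcard, Fintype.card_fin]⟩).2 ⟨x, hx⟩
  have := hf r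
  rw [hr] at this
  exact ⟨r, this⟩

namespace IsDodecahedral

variable {X : Set (EuclideanSpace ℝ (Fin 3))}

theorem range_span (h : IsDodecahedral X Y) :
    Set.range (fun r => Submodule.span ℝ {Y r}) = lineSystem X := by
  ext S
  constructor
  · rintro ⟨r, rfl⟩
    obtain ⟨x, hx, hr⟩ := h.sign r
    exact ⟨x, hx, (span_singleton_eq_of_sign hr).symm⟩
  · rintro ⟨x, hx, rfl⟩
    obtain ⟨r, hr⟩ := h.surj x hx
    exact ⟨r, span_singleton_eq_of_sign hr⟩

theorem isometricLines (h : IsDodecahedral X Y) :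
    IsometricLines (lineSystem X) dodecahedronDiagonals := by
  obtain ⟨O, hO⟩ := exists_isometry_of_gram_eq h.gram gram_dodecahedronUnit
  refine ⟨O, ?_⟩
  rw [← h.range_span, dodecahedronDiagonals_eq, ← Set.range_comp]
  congr 1
  ext1 r
  have h3 : IsUnit (√3)⁻¹ := by
    rw [isUnit_iff_ne_zero]; positivity
  change Submodule.map _ (Submodule.span ℝ {Y r}) = _
  rw [Submodule.map_span, Set.image_singleton]
  change Submodule.span ℝ {O (Y r)} = _
  rw [hO, dodecahedronUnit, Submodule.span_singleton_smul_eq h3]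

theorem isGramOfLines (h : IsDodecahedral X Y) (π : Equiv.Perm (Fin 10)) (ε : Fin 10 → ℤˣ)
    {G : Matrix (Fin 10) (Fin 10) ℝ}
    (hG : ∀ i j, G i j = ((ε i : ℤ) : ℝ) * ((ε j : ℤ) : ℝ) *
      dodecahedronMatrix (1 / 3) (√5 / 3) (π i) (π j)) : IsGramOfLines X G := by
  have hs (i : Fin 10) : ((ε i : ℤ) : ℝ) • Y (π i) = Y (π i) ∨
      ((ε i : ℤ) : ℝ) • Y (π i) = -Y (π i) := by
    rcases Int.units_eq_one_or (ε i) with e | e <;> rw [e] <;> simp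
  have hspan : (fun i => Submodule.span ℝ {((ε i : ℤ) : ℝ) • Y (π i)}) =
      (fun r => Submodule.span ℝ {Y r}) ∘ π := by
    ext1 i
    exact span_singleton_eq_of_sign (hs i)
  refine ⟨fun i => ((ε i : ℤ) : ℝ) • Y (π i), fun i => ?_, ?_, ?_, ?_⟩
  · change ‖((ε i : ℤ) : ℝ) • Y (π i)‖ = 1
    rcases hs i with e | e <;> rw [e]
    · exact norm_eq_one_of_gram h.gram _
    · rw [norm_neg, norm_eq_one_of_gram h.gram]
  · rw [hspan]
    exact (span_injective_of_gram h.gram).comp π.injective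
  · rw [hspan, π.surjective.range_comp, h.range_span]
  · ext i j
    rw [hG, Matrix.gram_apply, real_inner_smul_left, inner_smul_right, ← h.gram, Matrix.gram_apply,
      mul_assoc]

theorem exists_perm_of_isGramOfLines (h : IsDodecahedral X Y) {G : Matrix (Fin 10) (Fin 10) ℝ}
    (hG : IsGramOfLines X G) : ∃ (π : Equiv.Perm (Fin 10)) (ε : Fin 10 → ℤˣ),
      ∀ i j, G i j = ((ε i : ℤ) : ℝ) * ((ε j : ℤ) : ℝ) *
        dodecahedronMatrix (1 / 3) (√5 / 3) (π i) (π j) := by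
  obtain ⟨x, hn, hinj, hr, rfl⟩ := hG
  have hex (i : Fin 10) : ∃ (k : Fin 10) (ε : ℤˣ), x i = ((ε : ℤ) : ℝ) • Y k := by
    have : Submodule.span ℝ {x i} ∈ Set.range fun r => Submodule.span ℝ {Y r} := by
      rw [h.range_span, ← hr]
      exact ⟨i, rfl⟩
    obtain ⟨k, hk⟩ := this
    rcases sign_of_span_eq (hn i) (norm_eq_one_of_gram h.gram k) hk.symm with e | e
    · exact ⟨k, 1, by simp [e]⟩
    · exact ⟨k, -1, by simp [e]⟩
  choose k ε hx using hex
  have hk : Function.Injective k := by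
    intro i j hij
    refine hinj ?_
    have hs (i : Fin 10) : x i = Y (k i) ∨ x i = -Y (k i) := by
      rw [hx]
      rcases Int.units_eq_one_or (ε i) with e | e <;> rw [e] <;> simp
    change Submodule.span ℝ {x i} = Submodule.span ℝ {x j}
    rw [span_singleton_eq_of_sign (hs i), span_singleton_eq_of_sign (hs j), hij]
  refine ⟨Equiv.ofBijective k (Finite.injective_iff_bijective.1 hk), ε, fun i j => ?_⟩
  rw [Matrix.gram_apply, hx i, hx j, real_inner_smul_left, inner_smul_right, ← h.gram,
    Matrix.gram_apply, mul_assoc]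
  rfl

/-- Any Gram matrix of the lines is the dodecahedral one up to a signed permutation, so a candidate
is identified by lifting its values to symbols. Conversely, `a` and `b` are chosen so that the
relabeled symbols take the values `1/3` and `√5/3`. -/
theorem hasCandidateGram_iff (h : IsDodecahedral X Y) (C : Matrix (Fin 10) (Fin 10) SymbolRing) :
    HasCandidateGram X C ↔ CandidateEquiv C dodecahedronCandidate := by
  constructor
  · rintro ⟨hC, a, b, -, hG⟩
    obtain ⟨π, ε, hπ⟩ := h.exists_perm_of_isGramOfLines hG
    refine candidateEquiv_of_eq hC (by norm_num) (by positivity) ?_ π ε hπ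
    rw [sq_third]
    norm_num
  · intro hC
    refine ⟨isCandidateGram_of_equiv hC, ?_⟩
    obtain ⟨π, ε, s, t, hst, hC⟩ := hC
    obtain ⟨a, b, hs, ht, hab⟩ := hst.exists_values (1 / 3) (√5 / 3)
    rw [sq_third, show (1 / 3 : ℝ) ^ 2 = 1 / 9 by norm_num] at hab
    refine ⟨a, b, ?_, h.isGramOfLines π ε fun i j => ?_⟩
    · have ha : a ≠ 0 := by rintro rfl; rcases hab with h | h <;> norm_num at h
      have hb : b ≠ 0 := by rintro rfl; rcases hab with h | h <;> norm_num at h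
      have h2 : (a ^ 2 - b ^ 2) * ((a ^ 2 - 1) * (b ^ 2 - 1)) ≠ 0 := by
        rcases hab with ⟨h, h'⟩ | ⟨h, h'⟩ <;> rw [h, h'] <;> norm_num
      have := mul_ne_zero (mul_ne_zero ha hb) h2
      rwa [← mul_assoc, ← mul_assoc] at this
    · have := map_dodecahedronMatrix
        (MvPolynomial.aeval (R := ℚ) ![a, b] : SymbolRing →ₐ[ℚ] ℝ).toRingHom s t (π i) (π j)
      simp only [AlgHom.toRingHom_eq_coe, RingHom.coe_coe, hs, ht] at this
      change MvPolynomial.aeval ![a, b] (C i j) = _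
      rw [hC, substSymbols_dodecahedronCandidate, map_mul, map_mul, this, map_intCast, map_intCast]

theorem abs_innerProducts (h : IsDodecahedral X Y) (hX : SpansBiangularLines X) :
    (fun c : ℝ => |c|) '' innerProducts X = {1 / 3, √5 / 3} := by
  have habs {c : ℝ} {p : ℝ} (hp : 0 ≤ p) (hc : c ^ 2 = p ^ 2) : |c| = p := by
    rw [← abs_of_nonneg hp]
    exact (sq_eq_sq_iff_abs_eq_abs _ _).1 hc
  have h5 : (0 : ℝ) ≤ √5 / 3 := by positivity
  have mem {r s : Fin 10} (hrs : r ≠ s) {p : ℝ} (hp : 0 ≤ p)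
      (hm : dodecahedronMatrix (1 / 3) (√5 / 3) r s = p) :
      p ∈ (fun c : ℝ => |c|) '' innerProducts X := by
    obtain ⟨x, hx, hr⟩ := h.sign r
    obtain ⟨x', hx', hs⟩ := h.sign s
    refine ⟨_, ⟨x, hx, x', hx', ?_, rfl⟩, habs hp ?_⟩
    · rintro rfl
      refine not_sign_of_gram h.gram hrs ?_
      rcases hr with e | e <;> rcases hs with e' | e' <;> rw [e, e'] <;> simp
    · rw [← inner_sq_of_sign hr hs, ← Matrix.gram_apply, h.gram, hm]
  ext p
  constructor
  · rintro ⟨_, ⟨x, hx, x', hx', hne, rfl⟩, rfl⟩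
    obtain ⟨r, hr⟩ := h.surj x hx
    obtain ⟨s, hs⟩ := h.surj x' hx'
    have hrs : r ≠ s := by
      rintro rfl
      have hneg : x ≠ -x' := fun e => hX.2.1 ⟨x, hx, x', hx', hne, by
        rw [e, inner_neg_left, real_inner_self_eq_norm_sq, hX.1 x' hx', one_pow]⟩
      rcases hr with e | e <;> rcases hs with e' | e' <;> rw [e] at e'
      · exact hne e'
      · exact hneg e'
      · exact hneg (neg_eq_iff_eq_neg.1 e')
      · exact hne (neg_injective e')
    have := sq_inner_of_gram h.gram hrs
    rw [inner_sq_of_sign hr hs] at this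
    rcases this with e | e
    · exact Or.inl (habs (by norm_num) (by rw [e]; norm_num))
    · exact Or.inr (habs h5 (by rw [e, sq_third]))
  · rintro (rfl | rfl)
    -- Both values are attained in the first row of the matrix, at columns 1 and 7.
    · exact mem (r := 0) (s := 1) (by decide) (by norm_num) rfl
    · exact mem (r := 0) (s := 7) (by decide) h5 rfl

end IsDodecahedral

end Dodecahedral

theorem theorem4p1 :
    IsGreatest (Set.encard '' {X : Set (EuclideanSpace ℝ (Fin 3)) | SpansBiangularLines X}) 10 ∧
    ∀ X : Set (EuclideanSpace ℝ (Fin 3)), SpansBiangularLines X → X.encard = 10 →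
      IsometricLines (lineSystem X) dodecahedronDiagonals ∧
      (∀ C : Matrix (Fin 10) (Fin 10) SymbolRing,
        HasCandidateGram X C ↔ CandidateEquiv C dodecahedronCandidate) ∧
      IsGramOfLines X (substSymbols dodecahedronCandidate (1 / 3 : ℝ) (Real.sqrt 5 / 3)) ∧
      (fun c : ℝ => |c|) '' innerProducts X = {1 / 3, Real.sqrt 5 / 3} := by
  refine ⟨⟨⟨Set.range dodecahedronUnit, spansBiangularLines_range gram_dodecahedronUnit,
    encard_range gram_dodecahedronUnit⟩, ?_⟩, fun X hX hc => ?_⟩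
  · rintro _ ⟨X, hX, rfl⟩
    exact encard_le_ten hX
  · obtain ⟨Y, hY⟩ := hX.exists_isDodecahedral hc
    refine ⟨hY.isometricLines, hY.hasCandidateGram_iff, ?_, hY.abs_innerProducts hX⟩
    rw [substSymbols_dodecahedronCandidate]
    exact hY.isGramOfLines (Equiv.refl _) (fun _ => 1) fun i j => by simp
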